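/- **Conventions.** Directed paths and cycles have no repeated vertices; their length is their number of edges. A family $F_1,\dots,F_m$ of subgraphs of a digraph $G$ (members may coincide) is a *half-integral packing* if every vertex of $G$ lies in at most two of $F_1,\dots,F_m$. For $N\subseteq V(G)$, a *directed odd $N$-path* is a directed path of odd length with both endpoints in $N$ and no internal vertex in $N$. A *cylindrical wall* of order $n\ge 1$ is a digraph that is the union of $n$ pairwise vertex-disjoint directed cycles $C_1,\dots,C_n$ (columns) and $2n$ pairwise vertex-disjoint directed paths $P_1,\dots,P_{2n}$ (rows) such that: each $C_i\cap P_j$ is a directed path with at least one edge; both endpoints of each $P_j$ lie in $V(C_1)\cup V(C_n)$; the paths $P_1,\dots,P_{2n}$ appear in this order on each $C_i$; and the cycles appear on $P_j$ in the order $C_1,\dots,C_n$ if $j$ is odd and in the order $C_n,\dots,C_1$ if $j$ is even. A *nail* is a vertex whose in-degree or out-degree in the wall is $2$. The wall is *bipartite* if its underlying undirected graph is bipartite. **Proposition.** There is a function $g$ from the natural numbers to the positive integers such that the following holds. Let $k$ be a positive integer, let $G$ be a digraph, and let $W\subseteq G$ be a bipartite cylindrical wall of order at least $(2k+1)(6g(k)+1)$.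 Let $N$ be a set of nails of $W$ that is contained in one part of the bipartition of $W$. If $G$ has a half-integral packing of $12(g(k)-1)+1$ directed odd $N$-paths such that no two of these paths have a common endpoint, then $G$ contains a half-integral packing of $k$ directed odd cycles. -/

import Mathlib

namespace DiWall

variable {V : Type*}

/-! Directed paths and cycles are given by the lists of their (pairwise distinct) vertices in the
order of traversal; the list of a directed cycle may start at any vertex of the cycle. -/

/-- The edges `(v₀, v₁), …, (vₘ₋₁, vₘ)` of the path `v₀ v₁ … vₘ`. -/
def pathEdges (p : List V) : Set (V × V) := {e | [e.1, e.2] <:+: p}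

/-- The edges of the cycle `v₀ v₁ … vₘ v₀`, listed as `[v₀, v₁, …, vₘ]`. -/
def cycleEdges (c : List V) : Set (V × V) := pathEdges (c ++ c.take 1)

/-- The first and the last vertex of a path. -/
def pathEnds (p : List V) : Set V := {v | p.head? = some v ∨ p.getLast? = some v}

/-- The number of edges of a path. -/
def pathLength (p : List V) : ℕ := p.length - 1

/-- `p` is a directed path in `G`. -/
structure IsDirectedPath (G : Digraph V) (p : List V) : Prop where
  ne_nil : p ≠ []
  nodup : p.Nodup
  adj : ∀ e ∈ pathEdges p, G.Adj e.1 e.2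

/-- `c` is a directed cycle in `G`; its length is `c.length`. A cycle of length two consists of
two antiparallel edges, and a cycle of length one is a loop (if `G` has any). -/
structure IsDirectedCycle (G : Digraph V) (c : List V) : Prop where
  ne_nil : c ≠ []
  nodup : c.Nodup
  adj : ∀ e ∈ cycleEdges c, G.Adj e.1 e.2

/-- A directed odd cycle in `G`. -/
def IsOddCycle (G : Digraph V) (c : List V) : Prop := IsDirectedCycle G c ∧ Odd c.length

/-- A directed odd `N`-path in `G`: a directed path of odd length with both endpoints in `N` and
no internal vertex in `N`. -/
structure IsOddSetPath (G : Digraph V) (N : Set V) (p : List V) : Prop where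
  path : IsDirectedPath G p
  ends_mem : pathEnds p ⊆ N
  internal_notMem : ∀ v ∈ p.tail.dropLast, v ∉ N
  odd : Odd (pathLength p)

/-- A family of paths or cycles (members may repeat) is a half-integral packing if every vertex
lies in at most two of its members. -/
def IsHalfIntegralPacking {ι : Type*} (F : ι → List V) : Prop :=
  ∀ v : V, {i | v ∈ F i}.encard ≤ 2

/-- Along `l`, every vertex of `s` comes strictly before every vertex of `t`. -/
def Precedes (l s t : List V) : Prop :=
  ∀ (a b : ℕ) (u v : V), l[a]? = some u → l[b]? = some v → u ∈ s → v ∈ t → a < b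

/-- A cylindrical wall of order `n` with vertices in `V`. Indices start at `0`, so the columns
are `C₁ = col 0, …, Cₙ = col (n - 1)` and the rows are `P₁ = row 0, …, P₂ₙ = row (2n - 1)`. -/
structure CylindricalWall (V : Type*) (n : ℕ) where
  one_le : 1 ≤ n
  /-- The columns, directed cycles; the listing of a column starts at a vertex from which the
  traversal meets the rows in their order. -/
  col : Fin n → List V
  /-- The rows, directed paths. -/
  row : Fin (2 * n) → List V
  col_ne_nil : ∀ i, col i ≠ []
  col_nodup : ∀ i, (col i).Nodup
  row_ne_nil : ∀ j, row j ≠ []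
  row_nodup : ∀ j, (row j).Nodup
  col_disjoint : ∀ i i', i ≠ i' → (col i).Disjoint (col i')
  row_disjoint : ∀ j j', j ≠ j' → (row j).Disjoint (row j')
  /-- The intersection (of vertex sets and of edge sets) of a column and a row is a directed path
  `q` with at least one edge. -/
  inter : ∀ i j, ∃ q : List V, q.Nodup ∧ 1 ≤ pathLength q ∧
    (∀ v, v ∈ q ↔ v ∈ col i ∧ v ∈ row j) ∧
    pathEdges q = cycleEdges (col i) ∩ pathEdges (row j)
  /-- Both endpoints of each row lie in the first or the last column. -/
  row_ends : ∀ j, ∀ v ∈ pathEnds (row j), ∃ i : Fin n, (i.val = 0 ∨ i.val + 1 = n) ∧ v ∈ col i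
  /-- The rows `P₁, …, P₂ₙ` appear in this order on each column. -/
  col_order : ∀ i j j', j < j' → Precedes (col i) (row j) (row j')
  /-- The columns appear in the order `C₁, …, Cₙ` on `P₁, P₃, …`. -/
  row_order_fwd : ∀ j : Fin (2 * n), Even j.val →
    ∀ i i', i < i' → Precedes (row j) (col i) (col i')
  /-- The columns appear in the order `Cₙ, …, C₁` on `P₂, P₄, …`. -/
  row_order_bwd : ∀ j : Fin (2 * n), Odd j.val →
    ∀ i i', i < i' → Precedes (row j) (col i') (col i)

namespace CylindricalWall

variable {n : ℕ}

/-- The wall as a digraph, the union of its columns and rows. It has no isolated vertices; the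
elements of `V` that are on no column and no row are not vertices of the wall. -/
def toDigraph (W : CylindricalWall V n) : Digraph V where
  Adj u v := (∃ i, (u, v) ∈ cycleEdges (W.col i)) ∨ ∃ j, (u, v) ∈ pathEdges (W.row j)

/-- The nails: the vertices with in-degree two or out-degree two in the wall. -/
def nails (W : CylindricalWall V n) : Set V :=
  {v | {u | W.toDigraph.Adj u v}.encard = 2 ∨ {u | W.toDigraph.Adj v u}.encard = 2}

/-- `A` and `B` form a bipartition of the underlying undirected graph of the wall. -/
def IsBipartition (W : CylindricalWall V n) (A B : Set V) : Prop :=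
  W.toDigraph.toSimpleGraphInclusive.IsBipartiteWith A B

end CylindricalWall

end DiWall

/-! Let `χ` be the 2-colouring of the wall with value `false` on `N`. In the double cover of `G` the
wall lifts to two copies, formed by the vertices `(v, χ v)` and the vertices `(v, !χ v)`. A walk
from one copy to the other, closed up inside the wall, projects to an odd closed walk and so yields
an odd cycle. An odd `N`-path, lifted by the parity of the position, starts in the first copy and
ends in the second.

Cut the wall into regions, blocks of `k` consecutive columns with the row parts between them. A path
may run through every region, but `exists_sign_change` extracts a segment that meets at most `12 *
k` regions and still crosses robustly: it begins at the start of the path or with visits to `3 * k`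
regions in the first copy, and it finishes at the end of the path or with visits to `3 * k` regions
in the second. For `h` paths and `12 * k * h + 1` regions, some region `R` is missed by all
segments. Let `H` be the wall together with the segments.

Fewer than `3 * k` vertices do not separate the two lifts of `R` in the double cover of `H`
(`not_separates`): they hit few paths, by half-integrality, and cut few nails off from a column
(`card_nails_not_reach_to_col`, `card_nails_not_reach_from_col`). So `menger` gives `3 * k` disjoint
walks between the lifts. At `R` the graph `H` is just the wall, so each walk contains a jump that
leaves `R` along a row and returns along a row (`exists_jump`). By `exists_independent_indices`, `k`
of the jumps do not share rows, and `exists_oddCycles_of_linkage` closes each one along its rows and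
a private column. A vertex outside `R` has two lifts, hence lies on at most two cycles; a vertex of
`R` serves at most once on a row and once on a column. -/

namespace DiWall

/-! ### Walks inside a vertex set -/

variable {α : Type*}

/-- There is a walk from `u` to `v` all of whose vertices lie in `S`. -/
def Reach (r : α → α → Prop) (S : Set α) (u v : α) : Prop :=
  u ∈ S ∧ Relation.ReflTransGen (fun x y => r x y ∧ x ∈ S ∧ y ∈ S) u v

namespace Reach

variable {r r' : α → α → Prop} {S S' : Set α} {u v w : α}

theorem refl (hu : u ∈ S) : Reach r S u u := ⟨hu, .refl⟩

theorem left_mem (h : Reach r S u v) : u ∈ S := h.1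

theorem right_mem (h : Reach r S u v) : v ∈ S := by
  obtain ⟨hu, h⟩ := h
  induction h with
  | refl => exact hu
  | tail _ h _ => exact h.2.2

theorem trans (h : Reach r S u v) (h' : Reach r S v w) : Reach r S u w :=
  ⟨h.1, h.2.trans h'.2⟩

theorem single (h : r u v) (hu : u ∈ S) (hv : v ∈ S) : Reach r S u v :=
  ⟨hu, .single ⟨h, hu, hv⟩⟩

theorem mono (h : Reach r S u v) (hr : ∀ x ∈ S, ∀ y ∈ S, r x y → r' x y) (hS : S ⊆ S') :
    Reach r' S' u v :=
  ⟨hS h.1, Relation.ReflTransGen.mono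
    (fun x y hxy => ⟨hr x hxy.2.1 y hxy.2.2 hxy.1, hS hxy.2.1, hS hxy.2.2⟩) _ _ h.2⟩

theorem mono_set (h : Reach r S u v) (hS : S ⊆ S') : Reach r S' u v :=
  h.mono (fun _ _ _ _ h => h) hS

theorem swap (h : Reach r S u v) : Reach (Function.swap r) S v u := by
  refine ⟨h.right_mem, ?_⟩
  rw [← Relation.reflTransGen_swap]
  exact Relation.ReflTransGen.mono (fun x y hxy => ⟨hxy.1, hxy.2.2, hxy.2.1⟩) _ _ h.2

theorem head_induction {P : α → Prop} (h : Reach r S u v) (refl : v ∈ S → P v)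
    (head : ∀ a c, r a c → a ∈ S → Reach r S c v → P c → P a) : P u := by
  have hv := h.right_mem
  obtain ⟨-, h⟩ := h
  induction h using Relation.ReflTransGen.head_induction_on with
  | refl => exact refl hv
  | head hac hcb ih => exact head _ _ hac.1 hac.2.1 ⟨hac.2.2, hcb⟩ ih

/-- The initial part of a walk up to its first vertex in `T`. -/
theorem exists_first {T : Set α} (h : Reach r S u v) (hv : v ∈ T) :
    ∃ S' ⊆ S, ∃ t ∈ T, S' ∩ T ⊆ {t} ∧ Reach r S' u t ∧
      ∀ z ∈ S', Reach r (S' \ T ∪ {z}) u z := by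
  refine head_induction (P := fun u => ∃ S' ⊆ S, ∃ t ∈ T, S' ∩ T ⊆ {t} ∧ Reach r S' u t ∧
      ∀ z ∈ S', Reach r (S' \ T ∪ {z}) u z) h (fun hvS => ?_) (fun a c hac ha hc ih => ?_)
  · refine ⟨{v}, by simpa, v, hv, fun x hx => hx.1, refl rfl, ?_⟩
    rintro z rfl
    exact refl (by simp)
  · by_cases haT : a ∈ T
    · refine ⟨{a}, by simpa, a, haT, fun x hx => hx.1, refl rfl, ?_⟩
      rintro z rfl
      exact refl (by simp)
    · obtain ⟨S', hS', t, ht, hST, hr, hz⟩ := ih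
      refine ⟨insert a S', Set.insert_subset ha hS', t, ht, ?_, ?_, ?_⟩
      · rintro x ⟨rfl | hx, hxT⟩
        · exact absurd hxT haT
        · exact hST ⟨hx, hxT⟩
      · exact (single hac (by simp) (by simp [hr.left_mem])).trans
          (hr.mono_set (Set.subset_insert _ _))
      · rintro z (rfl | hzS)
        · exact refl (by simp)
        · have h1 := hz z hzS
          have hsub : S' \ T ∪ {z} ⊆ insert a S' \ T ∪ {z} := by
            intro x hx
            simp only [Set.mem_union, Set.mem_sdiff, Set.mem_insert_iff] at hx ⊢
            tauto
          exact (single hac (by simp [haT]) (hsub h1.left_mem)).trans (h1.mono_set hsub)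

/-- The final part of a walk from its last vertex in `T` on. -/
theorem exists_last {T : Set α} (h : Reach r S u v) (hu : u ∈ T) :
    ∃ S' ⊆ S, ∃ t ∈ T, S' ∩ T ⊆ {t} ∧ Reach r S' t v ∧
      ∀ z ∈ S', Reach r (S' \ T ∪ {z}) z v := by
  obtain ⟨S', hS, t, ht, h1, h2, h3⟩ := h.swap.exists_first hu
  exact ⟨S', hS, t, ht, h1, h2.swap, fun z hz => (h3 z hz).swap⟩

/-- A walk either reaches `T` or avoids it, before using an edge out of `T`. -/
theorem reach_or_avoid {T : Set α} (h : Reach r S u v)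
    (hr : ∀ x y, x ∉ T → r x y → r' x y) :
    (∃ t ∈ T, Reach r' S u t) ∨ Reach r' (S \ T) u v := by
  refine head_induction (P := fun u => (∃ t ∈ T, Reach r' S u t) ∨ Reach r' (S \ T) u v) h
    (fun hvS => ?_) (fun a c hac ha hc ih => ?_)
  · by_cases hvT : v ∈ T
    · exact .inl ⟨v, hvT, refl hvS⟩
    · exact .inr (refl (show v ∈ S \ T from ⟨hvS, hvT⟩))
  · by_cases haT : a ∈ T
    · exact .inl ⟨a, haT, refl ha⟩
    · rcases ih with ⟨t, ht, h⟩ | h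
      · exact .inl ⟨t, ht, (single (hr _ _ haT hac) ha h.left_mem).trans h⟩
      · exact .inr ((single (S := S \ T) (hr _ _ haT hac) ⟨ha, haT⟩ h.left_mem).trans h)

end Reach

/-! ### Menger's theorem -/

/-- The set `X` meets every walk from `A` to `B`. -/
def Separates (r : α → α → Prop) (A B X : Set α) : Prop :=
  ∀ a ∈ A, ∀ b ∈ B, ¬ Reach r Xᶜ a b

/-- Göring's induction on the edges. If the graph without `(x, y)` has a separator `X` with fewer
than `k` vertices, then `X ∪ {x}` and `X ∪ {y}` separate in the full graph, so both have exactly `k`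
vertices. Linkages from `A` to the first set and from the second set to `B` exist without the new
edge, meet only in `X`, and are glued there and along `(x, y)`. -/
theorem menger_edgeFinset [DecidableEq α] (E : Finset (α × α)) (k : ℕ) :
    ∀ (A B : Set α),
    (∀ X : Finset α, Separates (fun x y => (x, y) ∈ E) A B X → k ≤ X.card) →
    ∃ S : Fin k → Set α, Pairwise (fun i j => Disjoint (S i) (S j)) ∧
      ∀ i, ∃ a ∈ A, ∃ b ∈ B, Reach (fun x y => (x, y) ∈ E) (S i) a b := by
  induction E using Finset.induction_on with
  | empty =>
    intro A B hsep
    have hk : (k : ℕ∞) ≤ (A ∩ B).encard := by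
      by_contra! hlt
      have hfin : (A ∩ B).Finite := Set.finite_of_encard_le_coe hlt.le
      have := hsep hfin.toFinset (by
        intro a ha b hb h
        have hab : a = b := by
          obtain ⟨-, h⟩ := h
          induction h with
          | refl => rfl
          | tail _ h _ => simp at h
        subst hab
        exact h.left_mem (by simp [ha, hb]))
      rw [hfin.encard_eq_coe_toFinset_card] at hlt
      exact absurd (Nat.cast_lt.mp hlt) (not_lt.mpr this)
    obtain ⟨t, htS, ht⟩ := Set.exists_subset_encard_eq hk
    have hfin : t.Finite := Set.finite_of_encard_eq_coe ht
    have hcard : hfin.toFinset.card = k := by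
      rw [hfin.encard_eq_coe_toFinset_card] at ht
      exact_mod_cast ht
    let f := (hfin.toFinset.equivFinOfCardEq hcard).symm
    refine ⟨fun i => {(f i : α)}, ?_, ?_⟩
    · intro i j hij
      simp only [Set.disjoint_singleton]
      exact fun h => hij (f.injective (Subtype.ext h))
    · intro i
      have := htS (hfin.mem_toFinset.mp (f i).2)
      exact ⟨f i, this.1, f i, this.2, Reach.refl rfl⟩
  | insert e E he ih =>
    intro A B hsep
    obtain ⟨x, y⟩ := e
    have hmono : ∀ u v, (u, v) ∈ E → (u, v) ∈ insert (x, y) E :=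
      fun u v h => Finset.mem_insert_of_mem h
    by_cases hX : ∀ X : Finset α, Separates (fun x y => (x, y) ∈ E) A B X → k ≤ X.card
    · obtain ⟨S, hS, h⟩ := ih A B hX
      refine ⟨S, hS, fun i => ?_⟩
      obtain ⟨a, ha, b, hb, hr⟩ := h i
      exact ⟨a, ha, b, hb, hr.mono (fun _ _ _ _ h => hmono _ _ h) subset_rfl⟩
    push Not at hX
    obtain ⟨X, hXsep, hXk⟩ := hX
    have hdel : ∀ u v, u ≠ x → (u, v) ∈ insert (x, y) E → (u, v) ∈ E := by
      intro u v hu h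
      simpa [hu] using h
    have hdel' : ∀ u v, v ≠ y → (u, v) ∈ insert (x, y) E → (u, v) ∈ E := by
      intro u v hu h
      simpa [hu] using h
    have hXx : k ≤ (insert x X).card := hsep _ (by
      intro a ha b hb h
      refine hXsep a ha b hb (h.mono (fun u hu v _ huv => hdel u v ?_ huv) ?_)
      · rintro rfl; simp at hu
      · intro u hu; simp at hu ⊢; tauto)
    have hXy : k ≤ (insert y X).card := hsep _ (by
      intro a ha b hb h
      refine hXsep a ha b hb (h.mono (fun u _ v hv huv => hdel' u v ?_ huv) ?_)
      · rintro rfl; simp at hv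
      · intro u hu; simp at hu ⊢; tauto)
    have hcx := Finset.card_insert_le x X
    have hcy := Finset.card_insert_le y X
    have hyX : y ∉ X := fun h => by rw [Finset.insert_eq_of_mem h] at hXy; omega
    -- walks from `A` to `X ∪ {x}`
    obtain ⟨P, hP, hPr⟩ := ih A (insert x X : Finset α) (by
      intro Y hY
      refine hsep Y ?_
      intro a ha b hb h
      -- The new edge starts at `x`, so it cannot be used before `X ∪ {x}` is reached.
      rcases h.reach_or_avoid (T := (insert x X : Finset α)) (r' := fun x y => (x, y) ∈ E)
        (fun u v hu huv => hdel u v (by rintro rfl; simp at hu) huv) with ⟨t, ht, h⟩ | h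
      · exact hY a ha t ht h
      · refine hXsep a ha b hb (h.mono_set fun u hu => ?_)
        simp at hu ⊢; tauto)
    -- walks from `X ∪ {y}` to `B`
    obtain ⟨Q, hQ, hQr⟩ := ih (insert y X : Finset α) B (by
      intro Y hY
      refine hsep Y ?_
      intro a ha b hb h
      rcases h.swap.reach_or_avoid (T := (insert y X : Finset α)) (r' := fun x y => (y, x) ∈ E)
        (fun u v hu huv => hdel' v u (by rintro rfl; simp at hu) huv) with ⟨t, ht, h⟩ | h
      · exact hY t ht b hb h.swap
      · refine hXsep a ha b hb (h.swap.mono_set fun u hu => ?_)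
        simp at hu ⊢; tauto)
    have hP' : ∀ i, ∃ S' ⊆ P i, ∃ t ∈ (insert x X : Finset α), ∃ a ∈ A,
        S' ∩ (insert x X : Finset α) ⊆ {t} ∧ Reach (fun x y => (x, y) ∈ E) S' a t ∧
        ∀ z ∈ S', Reach (fun x y => (x, y) ∈ E) (S' \ (insert x X : Finset α) ∪ {z}) a z := by
      intro i
      obtain ⟨a, ha, b, hb, h⟩ := hPr i
      obtain ⟨S', h1, t, h2, h3, h4, h5⟩ := h.exists_first hb
      exact ⟨S', h1, t, h2, a, ha, h3, h4, h5⟩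
    have hQ' : ∀ i, ∃ S' ⊆ Q i, ∃ t ∈ (insert y X : Finset α), ∃ b ∈ B,
        S' ∩ (insert y X : Finset α) ⊆ {t} ∧ Reach (fun x y => (x, y) ∈ E) S' t b ∧
        ∀ z ∈ S', Reach (fun x y => (x, y) ∈ E) (S' \ (insert y X : Finset α) ∪ {z}) z b := by
      intro i
      obtain ⟨a, ha, b, hb, h⟩ := hQr i
      obtain ⟨S', h1, t, h2, h3, h4, h5⟩ := h.exists_last ha
      exact ⟨S', h1, t, h2, b, hb, h3, h4, h5⟩
    choose P' hPP p hpT a haA hPT hPa hPz using hP'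
    choose Q' hQQ q hqT b hbB hQT hQb hQz using hQ'
    -- A common vertex outside `X` would splice the two walks into one from `A` to `B` that avoids
    -- `X` and the new edge.
    have hmeet : ∀ i j z, z ∈ P' i → z ∈ Q' j → z ∈ X := by
      intro i j z hzP hzQ
      by_contra hzX
      refine hXsep (a i) (haA i) (b j) (hbB j) (((hPz i z hzP).mono_set ?_).trans
        ((hQz j z hzQ).mono_set ?_))
      · rintro u (hu | rfl)
        · simp at hu ⊢; tauto
        · simpa using hzX
      · rintro u (hu | rfl)
        · simp at hu ⊢; tauto
        · simpa using hzX
    have hqinj : Function.Injective q := by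
      intro i j hij
      by_contra hne
      exact Set.disjoint_left.mp (hQ hne) (hQQ i (hQb i).left_mem)
        (hij ▸ hQQ j (hQb j).left_mem)
    have hpinj : Function.Injective p := by
      intro i j hij
      by_contra hne
      exact Set.disjoint_left.mp (hP hne) (hPP i (hPa i).right_mem)
        (hij ▸ hPP j (hPa j).right_mem)
    have hqsurj : ∀ z ∈ insert y X, ∃ j, q j = z := by
      have himg : Finset.univ.image q = insert y X := by
        apply Finset.eq_of_subset_of_card_le
        · intro z hz
          obtain ⟨j, -, rfl⟩ := Finset.mem_image.mp hz
          exact hqT j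
        · rw [Finset.card_image_of_injective _ hqinj, Finset.card_univ, Fintype.card_fin]
          omega
      intro z hz
      rw [← himg] at hz
      obtain ⟨j, -, h⟩ := Finset.mem_image.mp hz
      exact ⟨j, h⟩
    have hmatch : ∀ i, ∃ j, (p i ∈ X ∧ q j = p i) ∨ (p i = x ∧ q j = y) := by
      intro i
      rcases Finset.mem_insert.mp (hpT i) with h | h
      · obtain ⟨j, hj⟩ := hqsurj y (Finset.mem_insert_self _ _)
        exact ⟨j, .inr ⟨h, hj⟩⟩
      · obtain ⟨j, hj⟩ := hqsurj (p i) (Finset.mem_insert_of_mem h)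
        exact ⟨j, .inl ⟨h, hj⟩⟩
    choose m hm using hmatch
    have hminj : Function.Injective m := by
      intro i j hij
      apply hpinj
      have hi := hm i
      have hj := hm j
      rw [← hij] at hj
      rcases hi with ⟨h1, h2⟩ | ⟨h1, h2⟩ <;> rcases hj with ⟨h3, h4⟩ | ⟨h3, h4⟩
      · rw [← h2, h4]
      · rw [h4] at h2; exact absurd (h2 ▸ h1) hyX
      · rw [h2] at h4; exact absurd (h4 ▸ h3) hyX
      · rw [h1, h3]
    have hPQ : ∀ i j z, z ∈ P' i → z ∈ Q' (m j) → i = j := by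
      intro i j z hzP hzQ
      have hzX := hmeet _ _ z hzP hzQ
      have h1 : z = p i := hPT i ⟨hzP, by simp [hzX]⟩
      have h2 : z = q (m j) := hQT (m j) ⟨hzQ, by simp [hzX]⟩
      apply hpinj
      rcases hm j with ⟨h3, h4⟩ | ⟨h3, h4⟩
      · rw [← h1, h2, h4]
      · rw [h4] at h2; exact absurd (h2 ▸ hzX) hyX
    refine ⟨fun i => P' i ∪ Q' (m i), ?_, ?_⟩
    · intro i j hij
      rw [Set.disjoint_left]
      rintro z (hz | hz) (hz' | hz')
      · exact Set.disjoint_left.mp (hP hij) (hPP _ hz) (hPP _ hz')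
      · exact hij (hPQ i j z hz hz')
      · exact hij (hPQ j i z hz' hz).symm
      · exact Set.disjoint_left.mp (hQ (hminj.ne hij)) (hQQ _ hz) (hQQ _ hz')
    · intro i
      refine ⟨a i, haA i, b (m i), hbB _, ?_⟩
      have h1 : Reach (fun u v => (u, v) ∈ insert (x, y) E) (P' i ∪ Q' (m i)) (a i) (p i) :=
        (hPa i).mono (fun _ _ _ _ h => hmono _ _ h) Set.subset_union_left
      have h2 : Reach (fun u v => (u, v) ∈ insert (x, y) E) (P' i ∪ Q' (m i)) (q (m i)) (b (m i)) :=
        (hQb _).mono (fun _ _ _ _ h => hmono _ _ h) Set.subset_union_right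
      refine h1.trans (Reach.trans ?_ h2)
      rcases hm i with ⟨h3, h4⟩ | ⟨h3, h4⟩
      · rw [h4]; exact Reach.refl h1.right_mem
      · exact Reach.single (by rw [h3, h4]; simp) h1.right_mem h2.left_mem

/-- Menger's theorem for vertex-disjoint walks from `A` to `B`. -/
theorem menger (r : α → α → Prop) (hfin : {e : α × α | r e.1 e.2}.Finite) (k : ℕ) (A B : Set α)
    (hsep : ∀ X : Finset α, Separates r A B X → k ≤ X.card) :
    ∃ S : Fin k → Set α, Pairwise (fun i j => Disjoint (S i) (S j)) ∧
      ∀ i, ∃ a ∈ A, ∃ b ∈ B, Reach r (S i) a b := by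
  classical
  have hr : r = fun x y => (x, y) ∈ hfin.toFinset := by
    ext x y; simp
  rw [hr] at hsep ⊢
  exact menger_edgeFinset _ k A B hsep

/-! ### The double cover and odd cycles -/

/-- The bipartite double cover of a relation. -/
def doubleCover {α : Type*} (r : α → α → Prop) (p q : α × Bool) : Prop := r p.1 q.1 ∧ q.2 = !p.2

/-- A repeated vertex splits an odd closed walk into two shorter closed walks, one of which is odd.
-/
theorem exists_nodup_odd_closed_walk {α : Type*} {r : α → α → Prop} (n : ℕ) :
    ∀ (x : α) (l : List α), l.length = n → (x :: (l ++ [x])).IsChain r → Odd (l.length + 1) →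
      ∃ c : List α, c ≠ [] ∧ c.Nodup ∧ (c ++ c.take 1).IsChain r ∧ Odd c.length ∧ c ⊆ x :: l := by
  induction n using Nat.strong_induction_on with
  | _ n ih =>
    intro x l hn hch hodd
    by_cases hnd : (x :: l).Nodup
    · exact ⟨x :: l, by simp, hnd, by simpa using hch, by simpa using hodd, fun _ h => h⟩
    by_cases hx : x ∈ l
    · obtain ⟨l1, l2, rfl⟩ := List.append_of_mem hx
      have hch' : ((x :: l1) ++ x :: (l2 ++ [x])).IsChain r := by simpa using hch
      obtain ⟨h1, h2⟩ := List.isChain_split.mp hch'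
      have hlen : l1.length + 1 + (l2.length + 1) = (l1 ++ x :: l2).length + 1 := by
        simp; omega
      rw [← hlen, Nat.odd_add'] at hodd
      by_cases h : Odd (l1.length + 1)
      · obtain ⟨c, hc⟩ := ih l1.length (by simp at hn; omega) x l1 rfl (by simpa using h1) h
        refine ⟨c, hc.1, hc.2.1, hc.2.2.1, hc.2.2.2.1, fun z hz => ?_⟩
        have := hc.2.2.2.2 hz
        simp at this ⊢; tauto
      · have h' : Odd (l2.length + 1) := hodd.mpr (Nat.not_odd_iff_even.mp h)
        obtain ⟨c, hc⟩ := ih l2.length (by simp at hn; omega) x l2 rfl (by simpa using h2) h'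
        refine ⟨c, hc.1, hc.2.1, hc.2.2.1, hc.2.2.2.1, fun z hz => ?_⟩
        have := hc.2.2.2.2 hz
        simp at this ⊢; tauto
    · have hl : ¬ l.Nodup := fun h => hnd (List.nodup_cons.mpr ⟨hx, h⟩)
      rw [List.nodup_iff_sublist] at hl
      push Not at hl
      obtain ⟨y, hy⟩ := hl
      obtain ⟨r1, r2, rfl, hy1, hy2⟩ := List.cons_sublist_iff.mp hy
      obtain ⟨l1, l2, rfl⟩ := List.append_of_mem hy1
      obtain ⟨l3, l4, rfl⟩ := List.append_of_mem (List.singleton_sublist.mp hy2)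
      have hch' : ((x :: l1) ++ y :: ((l2 ++ l3) ++ y :: (l4 ++ [x]))).IsChain r := by
        simpa using hch
      obtain ⟨h1, h2⟩ := List.isChain_split.mp hch'
      have h2' : ((y :: (l2 ++ l3)) ++ y :: (l4 ++ [x])).IsChain r := by simpa using h2
      obtain ⟨h3, h4⟩ := List.isChain_split.mp h2'
      have h5 : ((x :: l1) ++ y :: (l4 ++ [x])).IsChain r := List.isChain_split.mpr ⟨h1, h4⟩
      have hlen : (l2 ++ l3).length + 1 + ((l1 ++ y :: l4).length + 1)
          = (l1 ++ y :: l2 ++ (l3 ++ y :: l4)).length + 1 := by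
        simp; omega
      rw [← hlen, Nat.odd_add'] at hodd
      by_cases h : Odd ((l2 ++ l3).length + 1)
      · obtain ⟨c, hc⟩ := ih (l2 ++ l3).length (by simp at hn ⊢; omega) y (l2 ++ l3) rfl
          (by simpa using h3) h
        refine ⟨c, hc.1, hc.2.1, hc.2.2.1, hc.2.2.2.1, fun z hz => ?_⟩
        have := hc.2.2.2.2 hz
        simp at this ⊢; tauto
      · have h' : Odd ((l1 ++ y :: l4).length + 1) := hodd.mpr (Nat.not_odd_iff_even.mp h)
        obtain ⟨c, hc⟩ := ih (l1 ++ y :: l4).length (by simp at hn ⊢; omega) x (l1 ++ y :: l4) rfl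
          (by simpa using h5) h'
        refine ⟨c, hc.1, hc.2.1, hc.2.2.1, hc.2.2.2.1, fun z hz => ?_⟩
        have := hc.2.2.2.2 hz
        simp at this ⊢; tauto

/-- The second coordinate flips at every step, so the endpoints reveal the parity of the projected
walk. -/
theorem exists_list_of_reach_doubleCover {α : Type*} {r : α → α → Prop} {S : Set (α × Bool)}
    {p q : α × Bool} (h : Reach (doubleCover r) S p q) :
    p = q ∨ ∃ l : List α, (p.1 :: (l ++ [q.1])).IsChain r ∧ (Odd (l.length + 1) ↔ p.2 ≠ q.2) ∧
      ∀ x ∈ p.1 :: l, ∃ ε, (x, ε) ∈ S := by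
  refine Reach.head_induction (P := fun p => p = q ∨ ∃ l : List α,
    (p.1 :: (l ++ [q.1])).IsChain r ∧ (Odd (l.length + 1) ↔ p.2 ≠ q.2) ∧
      ∀ x ∈ p.1 :: l, ∃ ε, (x, ε) ∈ S) h (fun _ => .inl rfl) ?_
  rintro a c ⟨hr, hε⟩ ha - (rfl | ⟨l, h1, h2, h3⟩)
  · refine .inr ⟨[], by simpa using hr, by simp [hε], ?_⟩
    simp only [List.mem_singleton, forall_eq]
    exact ⟨a.2, ha⟩
  · refine .inr ⟨c.1 :: l, by simpa using ⟨hr, h1⟩, ?_, ?_⟩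
    · rw [List.length_cons, Nat.odd_add_one, h2, hε]
      cases a.2 <;> cases q.2 <;> simp
    · intro x hx
      rcases List.mem_cons.mp hx with rfl | hx
      · exact ⟨a.2, ha⟩
      · exact h3 x hx

theorem exists_oddCycle_of_reach_doubleCover {V : Type*} {G : Digraph V} {S : Set (V × Bool)}
    {u : V} {ε : Bool} (h : Reach (doubleCover G.Adj) S (u, ε) (u, !ε)) :
    ∃ c, IsOddCycle G c ∧ ∀ v ∈ c, ∃ ε, (v, ε) ∈ S := by
  rcases exists_list_of_reach_doubleCover h with h | ⟨l, h1, h2, h3⟩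
  · simp at h
  · obtain ⟨c, hc, hnd, hch, hodd, hsub⟩ := exists_nodup_odd_closed_walk l.length u l rfl h1
      (h2.mpr (by simp))
    refine ⟨c, ⟨⟨hc, hnd, fun e he => ?_⟩, hodd⟩, fun v hv => h3 v (hsub hv)⟩
    exact List.isChain_pair.mp (hch.infix he)

/-! ### Edges of listed paths and cycles -/

variable {V : Type*}

theorem mem_pathEdges {p : List V} {u v : V} :
    (u, v) ∈ pathEdges p ↔ ∃ i : ℕ, p[i]? = some u ∧ p[i + 1]? = some v := by
  constructor
  · rintro ⟨s, t, h⟩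
    simp only [List.append_assoc] at h
    subst h
    exact ⟨s.length, by simp, by simp⟩
  · rintro ⟨i, hu, hv⟩
    obtain ⟨hi, rfl⟩ := List.getElem?_eq_some_iff.mp hu
    obtain ⟨hi', rfl⟩ := List.getElem?_eq_some_iff.mp hv
    refine ⟨p.take i, p.drop (i + 2), ?_⟩
    have h1 : p.drop i = p[i] :: p[i + 1] :: p.drop (i + 2) := by
      rw [List.drop_eq_getElem_cons hi, List.drop_eq_getElem_cons hi']
    calc _ = p.take i ++ p.drop i := by rw [h1]; simp
      _ = p := List.take_append_drop i p

theorem mem_cycleEdges {p : List V} {u v : V} :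
    (u, v) ∈ cycleEdges p ↔ (∃ i : ℕ, p[i]? = some u ∧ p[i + 1]? = some v) ∨
      (p[p.length - 1]? = some u ∧ p[0]? = some v) := by
  rw [cycleEdges, mem_pathEdges]
  cases p with
  | nil => simp
  | cons a l =>
    simp only [List.take_succ_cons, List.take_zero]
    constructor
    · rintro ⟨i, h1, h2⟩
      have hlt : i + 1 < (a :: l ++ [a]).length := (List.getElem?_eq_some_iff.mp h2).1
      simp only [List.cons_append, List.length_cons, List.length_append, List.length_nil] at hlt
      rw [List.getElem?_append_left (by simp; omega)] at h1
      by_cases hi : i + 1 < (a :: l).length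
      · rw [List.getElem?_append_left hi] at h2
        exact .inl ⟨i, h1, h2⟩
      · rw [List.length_cons] at hi
        obtain rfl : i = l.length := by omega
        rw [List.getElem?_append_right (by simp)] at h2
        exact .inr ⟨by simpa using h1, by simpa using h2⟩
    · rintro (⟨i, h1, h2⟩ | ⟨h1, h2⟩)
      · refine ⟨i, ?_, ?_⟩
        · rw [List.getElem?_append_left (List.getElem?_eq_some_iff.mp h1).1, h1]
        · rw [List.getElem?_append_left (List.getElem?_eq_some_iff.mp h2).1, h2]
      · refine ⟨l.length, ?_, ?_⟩
        · rw [List.getElem?_append_left (by simp)]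
          simpa using h1
        · rw [List.getElem?_append_right (by simp)]
          simpa using h2

theorem getElem?_inj_of_nodup {p : List V} (hp : p.Nodup) {i j : ℕ} {u : V}
    (hi : p[i]? = some u) (hj : p[j]? = some u) : i = j :=
  (List.getElem?_inj (List.getElem?_eq_some_iff.mp hi).1 hp).mp (hi.trans hj.symm)

theorem pathEdges_left_unique {p : List V} (hp : p.Nodup) {u u' v : V}
    (h : (u, v) ∈ pathEdges p) (h' : (u', v) ∈ pathEdges p) : u = u' := by
  obtain ⟨i, hu, hv⟩ := mem_pathEdges.mp h
  obtain ⟨j, hu', hv'⟩ := mem_pathEdges.mp h'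
  obtain rfl : i = j := by simpa using getElem?_inj_of_nodup hp hv hv'
  simpa using hu.symm.trans hu'

theorem pathEdges_right_unique {p : List V} (hp : p.Nodup) {u v v' : V}
    (h : (u, v) ∈ pathEdges p) (h' : (u, v') ∈ pathEdges p) : v = v' := by
  obtain ⟨i, hu, hv⟩ := mem_pathEdges.mp h
  obtain ⟨j, hu', hv'⟩ := mem_pathEdges.mp h'
  obtain rfl : i = j := getElem?_inj_of_nodup hp hu hu'
  simpa using hv.symm.trans hv'

theorem cycleEdges_left_unique {p : List V} (hp : p.Nodup) {u u' v : V}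
    (h : (u, v) ∈ cycleEdges p) (h' : (u', v) ∈ cycleEdges p) : u = u' := by
  rcases mem_cycleEdges.mp h with ⟨i, hu, hv⟩ | ⟨hu, hv⟩ <;>
    rcases mem_cycleEdges.mp h' with ⟨j, hu', hv'⟩ | ⟨hu', hv'⟩
  · obtain rfl : i = j := by simpa using getElem?_inj_of_nodup hp hv hv'
    simpa using hu.symm.trans hu'
  · simpa using getElem?_inj_of_nodup hp hv hv'
  · simpa using getElem?_inj_of_nodup hp hv hv'
  · simpa using hu.symm.trans hu'

theorem cycleEdges_right_unique {p : List V} (hp : p.Nodup) {u v v' : V}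
    (h : (u, v) ∈ cycleEdges p) (h' : (u, v') ∈ cycleEdges p) : v = v' := by
  rcases mem_cycleEdges.mp h with ⟨i, hu, hv⟩ | ⟨hu, hv⟩ <;>
    rcases mem_cycleEdges.mp h' with ⟨j, hu', hv'⟩ | ⟨hu', hv'⟩
  · obtain rfl : i = j := getElem?_inj_of_nodup hp hu hu'
    simpa using hv.symm.trans hv'
  · have := getElem?_inj_of_nodup hp hu hu'
    have := (List.getElem?_eq_some_iff.mp hv).1
    omega
  · have := getElem?_inj_of_nodup hp hu hu'
    have := (List.getElem?_eq_some_iff.mp hv').1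
    omega
  · simpa using hv.symm.trans hv'

theorem mem_of_mem_pathEdges {p : List V} {u v : V} (h : (u, v) ∈ pathEdges p) : u ∈ p ∧ v ∈ p := by
  obtain ⟨i, hu, hv⟩ := mem_pathEdges.mp h
  exact ⟨List.mem_of_getElem? hu, List.mem_of_getElem? hv⟩

theorem mem_of_mem_cycleEdges {p : List V} {u v : V} (h : (u, v) ∈ cycleEdges p) :
    u ∈ p ∧ v ∈ p := by
  rcases mem_cycleEdges.mp h with ⟨i, hu, hv⟩ | ⟨hu, hv⟩ <;>
  exact ⟨List.mem_of_getElem? hu, List.mem_of_getElem? hv⟩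

/-- A stretch of a directed path gives a walk. -/
theorem Reach.of_path {r : V → V → Prop} {p : List V} {S : Set V}
    (hr : ∀ e ∈ pathEdges p, r e.1 e.2) {s t : ℕ} (hst : s ≤ t) {u v : V}
    (hu : p[s]? = some u) (hv : p[t]? = some v)
    (hS : ∀ i x, s ≤ i → i ≤ t → p[i]? = some x → x ∈ S) : Reach r S u v := by
  induction t, hst using Nat.le_induction generalizing v with
  | base =>
    obtain rfl : u = v := by simpa using hu.symm.trans hv
    exact Reach.refl (hS s u le_rfl le_rfl hu)
  | succ t hst ih =>
    have ht : t < p.length := by have := (List.getElem?_eq_some_iff.mp hv).1; omega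
    have hw := List.getElem?_eq_getElem ht
    refine (ih hw fun i x h1 h2 => hS i x h1 (by omega)).trans (Reach.single ?_
      (hS t _ hst (by omega) hw) (hS _ _ (by omega) le_rfl hv))
    exact hr (p[t], v) (mem_pathEdges.mpr ⟨t, hw, hv⟩)

/-- Any two vertices of a directed cycle are joined by a walk along the cycle. -/
theorem Reach.of_cycle {r : V → V → Prop} {p : List V} {S : Set V}
    (hr : ∀ e ∈ cycleEdges p, r e.1 e.2) (hS : ∀ x ∈ p, x ∈ S) {u v : V} (hu : u ∈ p)
    (hv : v ∈ p) : Reach r S u v := by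
  have hr' : ∀ e ∈ pathEdges p, r e.1 e.2 := fun e he =>
    hr e (mem_cycleEdges.mpr (.inl (mem_pathEdges.mp he)))
  obtain ⟨s, hs, hus⟩ := List.getElem_of_mem hu
  obtain ⟨t, ht, hvt⟩ := List.getElem_of_mem hv
  have hus' : p[s]? = some u := by rw [List.getElem?_eq_getElem hs, hus]
  have hvt' : p[t]? = some v := by rw [List.getElem?_eq_getElem ht, hvt]
  have h0 : p[0]? = some (p[0]'(by omega)) := List.getElem?_eq_getElem _
  have h1 : p[p.length - 1]? = some (p[p.length - 1]'(by omega)) := List.getElem?_eq_getElem _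
  refine (Reach.of_path hr' (t := p.length - 1) (by omega) hus' h1 fun i x _ _ h =>
    hS x (List.mem_of_getElem? h)).trans (Reach.trans ?_ (Reach.of_path hr' (Nat.zero_le t) h0 hvt'
    fun i x _ _ h => hS x (List.mem_of_getElem? h)))
  exact Reach.single (hr (_, _) (mem_cycleEdges.mpr (.inr ⟨h1, h0⟩)))
    (hS _ (List.mem_of_getElem? h1)) (hS _ (List.mem_of_getElem? h0))

/-! ### Basic properties of the wall and its nails -/

namespace CylindricalWall

variable {n : ℕ} (W : CylindricalWall V n)

theorem adj_of_col {i : Fin n} : ∀ e ∈ cycleEdges (W.col i), W.toDigraph.Adj e.1 e.2 :=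
  fun _ he => .inl ⟨i, he⟩

theorem adj_of_row {j : Fin (2 * n)} : ∀ e ∈ pathEdges (W.row j), W.toDigraph.Adj e.1 e.2 :=
  fun _ he => .inr ⟨j, he⟩

theorem exists_mem_inter (i : Fin n) (j : Fin (2 * n)) : ∃ v, v ∈ W.col i ∧ v ∈ W.row j := by
  obtain ⟨q, -, h, hq, -⟩ := W.inter i j
  cases q with
  | nil => simp [pathLength] at h
  | cons v q => exact ⟨v, (hq v).mp (by simp)⟩

theorem col_unique {i i' : Fin n} {v : V} (h : v ∈ W.col i) (h' : v ∈ W.col i') : i = i' := by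
  by_contra hne
  exact W.col_disjoint i i' hne h h'

theorem row_unique {j j' : Fin (2 * n)} {v : V} (h : v ∈ W.row j) (h' : v ∈ W.row j') :
    j = j' := by
  by_contra hne
  exact W.row_disjoint j j' hne h h'

theorem two_le_length_col (i : Fin n) : 2 ≤ (W.col i).length := by
  have hn := W.one_le
  obtain ⟨q, hnd, h, hq, -⟩ := W.inter i ⟨0, by omega⟩
  have h1 : q.length ≤ (W.col i).length :=
    (List.subperm_of_subset hnd fun v hv => ((hq v).mp hv).1).length_le
  rw [pathLength] at h
  omega

theorem ne_of_adj {u v : V} (h : W.toDigraph.Adj u v) : u ≠ v := by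
  rintro rfl
  rcases h with ⟨i, h⟩ | ⟨j, h⟩
  · rcases mem_cycleEdges.mp h with ⟨s, hu, hv⟩ | ⟨hu, hv⟩
    · simpa using getElem?_inj_of_nodup (W.col_nodup i) hu hv
    · have := getElem?_inj_of_nodup (W.col_nodup i) hu hv
      have := W.two_le_length_col i
      omega
  · obtain ⟨s, hu, hv⟩ := mem_pathEdges.mp h
    simpa using getElem?_inj_of_nodup (W.row_nodup j) hu hv

theorem finite_adj : {e : V × V | W.toDigraph.Adj e.1 e.2}.Finite := by
  have h1 : (⋃ i, {v | v ∈ W.col i} ∪ ⋃ j, {v | v ∈ W.row j}).Finite :=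
    Set.finite_iUnion fun i => (List.finite_toSet _).union (Set.finite_iUnion fun j =>
      List.finite_toSet _)
  refine (h1.prod h1).subset ?_
  have hn := W.one_le
  rintro ⟨u, v⟩ (⟨i, h⟩ | ⟨j, h⟩)
  · have := mem_of_mem_cycleEdges h
    exact ⟨Set.mem_iUnion.mpr ⟨i, .inl this.1⟩, Set.mem_iUnion.mpr ⟨i, .inl this.2⟩⟩
  · have := mem_of_mem_pathEdges h
    exact ⟨Set.mem_iUnion.mpr ⟨⟨0, hn⟩, .inr (Set.mem_iUnion.mpr ⟨j, this.1⟩)⟩,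
      Set.mem_iUnion.mpr ⟨⟨0, hn⟩, .inr (Set.mem_iUnion.mpr ⟨j, this.2⟩)⟩⟩

theorem exists_coloring {A B : Set V} (h : W.IsBipartition A B) :
    ∃ χ : V → Bool, (∀ v ∈ A, χ v = false) ∧
      ∀ u v, W.toDigraph.Adj u v → χ v = !χ u := by
  classical
  refine ⟨fun v => decide (v ∈ B), fun v hv => ?_, fun u v huv => ?_⟩
  · simpa using Set.disjoint_left.mp h.disjoint hv
  · have hadj : W.toDigraph.toSimpleGraphInclusive.Adj u v := ⟨W.ne_of_adj huv, .inl huv⟩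
    rcases h.mem_of_adj hadj with ⟨h1, h2⟩ | ⟨h1, h2⟩
    · have := Set.disjoint_left.mp h.disjoint h1
      simp [h2, this]
    · have := Set.disjoint_left.mp h.disjoint h2
      simp [h1, this]

/-- Every nail is the first or the last vertex of the intersection of a column and a row. -/
theorem exists_nail_parametrization : ∃ f : Fin n → Fin (2 * n) → Bool → V,
    ∀ v ∈ W.nails, ∃ i j b, f i j b = v ∧ v ∈ W.col i ∧ v ∈ W.row j := by
  choose q hnd hlen hmem hedge using W.inter
  have hpos : ∀ i j, 0 < (q i j).length := fun i j => by
    have := hlen i j; rw [pathLength] at this; omega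
  refine ⟨fun i j b => if b then (q i j)[0]'(hpos i j) else
    (q i j)[(q i j).length - 1]'(by have := hpos i j; omega), ?_⟩
  rintro v (h | h)
  -- Disjoint columns supply at most one edge into `v`, and so do disjoint rows; hence one edge is
  -- of each kind.
  · have key : ∃ i j u u', u ≠ u' ∧ (u, v) ∈ cycleEdges (W.col i) ∧
        (u', v) ∈ pathEdges (W.row j) := by
      obtain ⟨u, u', hne, heq⟩ := Set.encard_eq_two.mp h
      have hu : W.toDigraph.Adj u v := heq.symm.subset (by simp)
      have hu' : W.toDigraph.Adj u' v := heq.symm.subset (by simp)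
      rcases hu with ⟨i, hu⟩ | ⟨j, hu⟩ <;> rcases hu' with ⟨i', hu'⟩ | ⟨j', hu'⟩
      · obtain rfl := W.col_unique (mem_of_mem_cycleEdges hu).2 (mem_of_mem_cycleEdges hu').2
        exact absurd (cycleEdges_left_unique (W.col_nodup i) hu hu') hne
      · exact ⟨i, j', u, u', hne, hu, hu'⟩
      · exact ⟨i', j, u', u, hne.symm, hu', hu⟩
      · obtain rfl := W.row_unique (mem_of_mem_pathEdges hu).2 (mem_of_mem_pathEdges hu').2
        exact absurd (pathEdges_left_unique (W.row_nodup j) hu hu') hne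
    obtain ⟨i, j, u, u', hne, hu, hu'⟩ := key
    have hvi := (mem_of_mem_cycleEdges hu).2
    have hvj := (mem_of_mem_pathEdges hu').2
    refine ⟨i, j, true, ?_, hvi, hvj⟩
    obtain ⟨m, hm, hmv⟩ := List.getElem_of_mem ((hmem i j v).mpr ⟨hvi, hvj⟩)
    rcases m with _ | m
    · simpa using hmv
    · have hm' : m < (q i j).length := by omega
      -- A predecessor of `v` on the intersection would be the tail of both edges into `v`.
      have he : ((q i j)[m], v) ∈ pathEdges (q i j) :=
        mem_pathEdges.mpr ⟨m, List.getElem?_eq_getElem hm', by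
          rw [List.getElem?_eq_getElem hm, hmv]⟩
      rw [hedge] at he
      exact absurd ((cycleEdges_left_unique (W.col_nodup i) hu he.1).trans
        (pathEdges_left_unique (W.row_nodup j) he.2 hu')) hne
  · have key : ∃ i j u u', u ≠ u' ∧ (v, u) ∈ cycleEdges (W.col i) ∧
        (v, u') ∈ pathEdges (W.row j) := by
      obtain ⟨u, u', hne, heq⟩ := Set.encard_eq_two.mp h
      have hu : W.toDigraph.Adj v u := heq.symm.subset (by simp)
      have hu' : W.toDigraph.Adj v u' := heq.symm.subset (by simp)
      rcases hu with ⟨i, hu⟩ | ⟨j, hu⟩ <;> rcases hu' with ⟨i', hu'⟩ | ⟨j', hu'⟩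
      · obtain rfl := W.col_unique (mem_of_mem_cycleEdges hu).1 (mem_of_mem_cycleEdges hu').1
        exact absurd (cycleEdges_right_unique (W.col_nodup i) hu hu') hne
      · exact ⟨i, j', u, u', hne, hu, hu'⟩
      · exact ⟨i', j, u', u, hne.symm, hu', hu⟩
      · obtain rfl := W.row_unique (mem_of_mem_pathEdges hu).1 (mem_of_mem_pathEdges hu').1
        exact absurd (pathEdges_right_unique (W.row_nodup j) hu hu') hne
    obtain ⟨i, j, u, u', hne, hu, hu'⟩ := key
    have hvi := (mem_of_mem_cycleEdges hu).1
    have hvj := (mem_of_mem_pathEdges hu').1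
    refine ⟨i, j, false, ?_, hvi, hvj⟩
    obtain ⟨m, hm, hmv⟩ := List.getElem_of_mem ((hmem i j v).mpr ⟨hvi, hvj⟩)
    by_cases hlast : m + 1 < (q i j).length
    · have he : (v, (q i j)[m + 1]) ∈ pathEdges (q i j) :=
        mem_pathEdges.mpr ⟨m, by rw [List.getElem?_eq_getElem hm, hmv],
          List.getElem?_eq_getElem hlast⟩
      rw [hedge] at he
      exact absurd ((cycleEdges_right_unique (W.col_nodup i) hu he.1).trans
        (pathEdges_right_unique (W.row_nodup j) he.2 hu')) hne
    · obtain rfl : m = (q i j).length - 1 := by omega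
      simpa using hmv

end CylindricalWall

/-! ### Signed label sequences -/

open Classical in
/-- The labels that occur at a position in `[s, t]` satisfying `p`. -/
noncomputable def labelsOn {q : ℕ} (hit : ℕ → Fin q → Prop) (p : ℕ → Prop) (s t : ℕ) :
    Finset (Fin q) :=
  Finset.univ.filter fun a => ∃ i, s ≤ i ∧ i ≤ t ∧ p i ∧ hit i a

section labelsOn

variable {q : ℕ} {hit : ℕ → Fin q → Prop} {p : ℕ → Prop} {s m t : ℕ}

theorem mem_labelsOn {a : Fin q} :
    a ∈ labelsOn hit p s t ↔ ∃ i, s ≤ i ∧ i ≤ t ∧ p i ∧ hit i a := by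
  simp [labelsOn]

theorem card_labelsOn_self_le (hit_unique : ∀ i a b, hit i a → hit i b → a = b) :
    (labelsOn hit p s s).card ≤ 1 := by
  rw [Finset.card_le_one]
  intro a ha b hb
  obtain ⟨i, h1, h2, -, h⟩ := mem_labelsOn.mp ha
  obtain ⟨i', h1', h2', -, h'⟩ := mem_labelsOn.mp hb
  obtain rfl : i = i' := by omega
  exact hit_unique i a b h h'

theorem card_labelsOn_le_add :
    (labelsOn hit p s t).card ≤ (labelsOn hit p s m).card + (labelsOn hit p m t).card := by
  refine (Finset.card_le_card fun a ha => ?_).trans (Finset.card_union_le _ _)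
  obtain ⟨i, h1, h2, h3, h⟩ := mem_labelsOn.mp ha
  rcases le_total i m with him | him
  · exact Finset.mem_union_left _ (mem_labelsOn.mpr ⟨i, h1, him, h3, h⟩)
  · exact Finset.mem_union_right _ (mem_labelsOn.mpr ⟨i, him, h2, h3, h⟩)

theorem card_labelsOn_succ_le (hit_unique : ∀ i a b, hit i a → hit i b → a = b) :
    (labelsOn hit p s (t + 1)).card ≤ (labelsOn hit p s t).card + 1 := by
  have : labelsOn hit p s (t + 1) ⊆ labelsOn hit p s t ∪ labelsOn hit p (t + 1) (t + 1) := by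
    intro a ha
    obtain ⟨i, h1, h2, h3, h⟩ := mem_labelsOn.mp ha
    rcases Nat.le_or_eq_of_le_succ h2 with h4 | rfl
    · exact Finset.mem_union_left _ (mem_labelsOn.mpr ⟨i, h1, h4, h3, h⟩)
    · exact Finset.mem_union_right _ (mem_labelsOn.mpr ⟨_, le_rfl, le_rfl, h3, h⟩)
  refine (Finset.card_le_card this).trans ((Finset.card_union_le _ _).trans ?_)
  have := card_labelsOn_self_le (p := p) (s := t + 1) hit_unique
  omega

theorem card_labelsOn_le_sign (sgn : ℕ → Bool) :
    (labelsOn hit (fun _ => True) s t).card ≤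
      (labelsOn hit (fun i => sgn i = false) s t).card +
        (labelsOn hit (fun i => sgn i = true) s t).card := by
  refine (Finset.card_le_card fun a ha => ?_).trans (Finset.card_union_le _ _)
  obtain ⟨i, h1, h2, h3, h⟩ := mem_labelsOn.mp ha
  cases hs : sgn i
  · exact Finset.mem_union_left _ (mem_labelsOn.mpr ⟨i, h1, h2, hs, h⟩)
  · exact Finset.mem_union_right _ (mem_labelsOn.mpr ⟨i, h1, h2, hs, h⟩)

end labelsOn

/-- In a signed sequence of labels there is an interval with few labels whose first part is either
initial or has many negative labels, and whose second part is either final or has many positive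
labels. -/
theorem exists_sign_change {q : ℕ} {hit : ℕ → Fin q → Prop}
    (hit_unique : ∀ i a b, hit i a → hit i b → a = b) (sgn : ℕ → Bool) {r : ℕ} (hr : 1 ≤ r)
    (L : ℕ) :
    ∃ s m t, s ≤ m ∧ m ≤ t ∧ t ≤ L ∧
      (s = 0 ∨ r ≤ (labelsOn hit (fun i => sgn i = false) s m).card) ∧
      (t = L ∨ r ≤ (labelsOn hit (fun i => sgn i = true) m t).card) ∧
      (labelsOn hit (fun _ => True) s t).card ≤ 4 * r := by
  -- Sweep with the invariant that a valid first part `[s, m]` with at most `2 * r` labels has been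
  -- found; the induction is on the remaining length `L - m`.
  have key : ∀ d m, L - m = d → m ≤ L →
      (∃ s ≤ m, (s = 0 ∨ r ≤ (labelsOn hit (fun i => sgn i = false) s m).card) ∧
        (labelsOn hit (fun _ => True) s m).card ≤ 2 * r) →
      ∃ s m t, s ≤ m ∧ m ≤ t ∧ t ≤ L ∧
      (s = 0 ∨ r ≤ (labelsOn hit (fun i => sgn i = false) s m).card) ∧
      (t = L ∨ r ≤ (labelsOn hit (fun i => sgn i = true) m t).card) ∧
      (labelsOn hit (fun _ => True) s t).card ≤ 4 * r := by
    intro d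
    induction d using Nat.strong_induction_on with
    | _ d ih =>
      rintro m rfl hmL ⟨s, hsm, hs, hcard⟩
      by_cases hL : (labelsOn hit (fun _ => True) m L).card ≤ 2 * r
      · refine ⟨s, m, L, hsm, hmL, le_rfl, hs, .inl rfl, ?_⟩
        have := card_labelsOn_le_add (hit := hit) (p := fun _ => True) (s := s) (m := m) (t := L)
        omega
      · have hex : ∃ e, 2 * r ≤ (labelsOn hit (fun _ => True) m (m + e)).card :=
          ⟨L - m, by rw [Nat.add_sub_cancel' hmL]; omega⟩
        classical
        -- The shortest continuation with `2 * r` labels has exactly that many, since each position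
        -- adds at most one.
        obtain ⟨e, he, hmin⟩ : ∃ e, 2 * r ≤ (labelsOn hit (fun _ => True) m (m + e)).card ∧
            ∀ e' < e, ¬ 2 * r ≤ (labelsOn hit (fun _ => True) m (m + e')).card :=
          ⟨Nat.find hex, Nat.find_spec hex, fun e' => Nat.find_min hex⟩
        have heL : m + e ≤ L := by
          by_contra hlt
          exact hmin (L - m) (by omega) (by rw [Nat.add_sub_cancel' hmL]; omega)
        have h0 := card_labelsOn_self_le (p := fun _ => True) (s := m) hit_unique
        obtain ⟨e, rfl⟩ : ∃ e', e = e' + 1 := by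
          rcases e with _ | e
          · rw [Nat.add_zero] at he; omega
          · exact ⟨e, rfl⟩
        have hle : (labelsOn hit (fun _ => True) m (m + (e + 1))).card ≤ 2 * r := by
          have h1 := hmin e (by omega)
          have h2 := card_labelsOn_succ_le (p := fun _ => True) (s := m) (t := m + e) hit_unique
          rw [← add_assoc]
          omega
        have hsg := card_labelsOn_le_sign (hit := hit) (s := m) (t := m + (e + 1)) sgn
        by_cases h1 : r ≤ (labelsOn hit (fun i => sgn i = true) m (m + (e + 1))).card
        · refine ⟨s, m, m + (e + 1), hsm, by omega, heL, hs, .inr h1, ?_⟩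
          have := card_labelsOn_le_add (hit := hit) (p := fun _ => True) (s := s) (m := m)
            (t := m + (e + 1))
          omega
        -- With fewer than `r` positive labels, the continuation has at least `r` negative ones and
        -- becomes the new first part.
        · exact ih (L - (m + (e + 1))) (by omega) _ rfl heL
            ⟨m, by omega, .inr (by omega), hle⟩
  refine key _ 0 rfl (Nat.zero_le _) ⟨0, le_rfl, .inl rfl, ?_⟩
  have h0 := card_labelsOn_self_le (p := fun _ => True) (s := 0) hit_unique
  omega

/-! ### Reaching a column after deleting few vertices -/

namespace CylindricalWall

variable {n : ℕ} (W : CylindricalWall V n)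

theorem reach_along_row {S : Set V} {i i' : Fin n} {j : Fin (2 * n)} {u v : V}
    (hui : u ∈ W.col i) (huj : u ∈ W.row j) (hvi : v ∈ W.col i') (hvj : v ∈ W.row j)
    (hdir : (i < i' ∧ Even j.val) ∨ (i' < i ∧ Odd j.val)) (hS : ∀ x ∈ W.row j, x ∈ S) :
    Reach W.toDigraph.Adj S u v := by
  obtain ⟨s, hs⟩ := List.mem_iff_getElem?.mp huj
  obtain ⟨t, ht⟩ := List.mem_iff_getElem?.mp hvj
  have hst : s < t := by
    rcases hdir with ⟨h, hj⟩ | ⟨h, hj⟩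
    · exact W.row_order_fwd j hj i i' h s t u v hs ht hui hvi
    · exact W.row_order_bwd j hj i' i h s t u v hs ht hui hvi
  exact Reach.of_path W.adj_of_row hst.le hs ht fun p x _ _ h => hS x (List.mem_of_getElem? h)

/-- There are `n` disjoint rows of each parity, too many for `X` to meet them all. -/
theorem exists_free_row {X : Finset V} (hX : X.card < n) (e : Bool) :
    ∃ j : Fin (2 * n), (if e then Even j.val else Odd j.val) ∧ ∀ x ∈ W.row j, x ∉ X := by
  by_contra! hcon
  have h : ∀ i : Fin n, ∃ x ∈ X, ∃ j : Fin (2 * n), j.val / 2 = i.val ∧ x ∈ W.row j := by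
    intro i
    have hi := i.2
    cases e
    · obtain ⟨x, hx, hxX⟩ := hcon ⟨2 * i.val + 1, by omega⟩ (by simp)
      exact ⟨x, hxX, _, by simp; omega, hx⟩
    · obtain ⟨x, hx, hxX⟩ := hcon ⟨2 * i.val, by omega⟩ (by simp)
      exact ⟨x, hxX, _, by simp, hx⟩
  choose x hxX j hj hxj using h
  have := Finset.card_le_card_of_injOn (s := Finset.univ) (t := X) x (fun i _ => hxX i) (by
    intro i _ i' _ heq
    have h1 := hxj i'
    rw [← heq] at h1
    have h2 := W.row_unique (hxj i) h1
    exact Fin.ext (by rw [← hj i, ← hj i', h2]))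
  simp at this
  omega

theorem exists_dir_row {X : Finset V} (hX : X.card < n) {i i' : Fin n} (hne : i ≠ i') :
    ∃ j : Fin (2 * n), ((i < i' ∧ Even j.val) ∨ (i' < i ∧ Odd j.val)) ∧ ∀ x ∈ W.row j, x ∉ X := by
  rcases lt_or_gt_of_ne hne with h | h
  · obtain ⟨j, hj, hjX⟩ := W.exists_free_row hX true
    exact ⟨j, .inl ⟨h, by simpa using hj⟩, hjX⟩
  · obtain ⟨j, hj, hjX⟩ := W.exists_free_row hX false
    exact ⟨j, .inr ⟨h, by simpa using hj⟩, hjX⟩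

/-- Follow the free column to a free row that runs towards the target column. -/
theorem exists_reach_to_col {X : Finset V} (hX : X.card < n) {i : Fin n}
    (hi : ∀ x ∈ W.col i, x ∉ X) {v : V} (hv : v ∈ W.col i) (i' : Fin n) :
    ∃ y ∈ W.col i', Reach W.toDigraph.Adj (X : Set V)ᶜ v y := by
  by_cases hne : i = i'
  · subst hne
    exact ⟨v, hv, Reach.refl (by simpa using hi v hv)⟩
  · obtain ⟨j, hdir, hj⟩ := W.exists_dir_row hX hne
    obtain ⟨z, hzi, hzj⟩ := W.exists_mem_inter i j
    obtain ⟨y, hyi, hyj⟩ := W.exists_mem_inter i' j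
    exact ⟨y, hyi, (Reach.of_cycle W.adj_of_col (by simpa using hi) hv hzi).trans
      (W.reach_along_row hzi hzj hyi hyj hdir (by simpa using hj))⟩

theorem exists_reach_from_col {X : Finset V} (hX : X.card < n) {i : Fin n}
    (hi : ∀ x ∈ W.col i, x ∉ X) {v : V} (hv : v ∈ W.col i) (i' : Fin n) :
    ∃ y ∈ W.col i', Reach W.toDigraph.Adj (X : Set V)ᶜ y v := by
  by_cases hne : i' = i
  · subst hne
    exact ⟨v, hv, Reach.refl (by simpa using hi v hv)⟩
  · obtain ⟨j, hdir, hj⟩ := W.exists_dir_row hX hne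
    obtain ⟨z, hzi, hzj⟩ := W.exists_mem_inter i j
    obtain ⟨y, hyi, hyj⟩ := W.exists_mem_inter i' j
    exact ⟨y, hyi, (W.reach_along_row hyi hyj hzi hzj hdir (by simpa using hj)).trans
      (Reach.of_cycle W.adj_of_col (by simpa using hi) hzi hv)⟩

/-- Every vertex of a column has a height between the indices of the rows met before and those of
the rows met after it. -/
theorem exists_height (i : Fin n) (x : V) : ∃ τ : ℕ, ∀ (j j' : Fin (2 * n)) (s p t : ℕ) (u w : V),
    s ≤ p → p ≤ t → (W.col i)[s]? = some u → (W.col i)[p]? = some x → (W.col i)[t]? = some w →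
    u ∈ W.row j → w ∈ W.row j' → j.val ≤ τ ∧ τ ≤ j'.val := by
  classical
  let T : Finset (Fin (2 * n)) := Finset.univ.filter fun j => ∃ s p u, (s : ℕ) ≤ p ∧
    (W.col i)[s]? = some u ∧ (W.col i)[p]? = some x ∧ u ∈ W.row j
  -- The height is the largest index of a row met up to `x`.
  refine ⟨T.sup fun j : Fin (2 * n) => j.val, ?_⟩
  intro j j' s p t u w hsp hpt hu hx hw huj hwj
  constructor
  · exact Finset.le_sup (f := fun j : Fin (2 * n) => j.val)
      (by
        simp only [T, Finset.mem_filter, Finset.mem_univ, true_and]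
        exact ⟨s, p, u, hsp, hu, hx, huj⟩)
  · refine Finset.sup_le fun j₁ hj₁ => ?_
    simp only [T, Finset.mem_filter, Finset.mem_univ, true_and] at hj₁
    obtain ⟨s₁, p₁, u₁, h1, h2, h3, h4⟩ := hj₁
    obtain rfl := getElem?_inj_of_nodup (W.col_nodup i) hx h3
    by_contra hlt
    have := W.col_order i j' j₁ (not_le.mp hlt) t s₁ w u₁ hw h2 hwj h4
    omega

theorem exists_rowIndex : ∃ ρ : V → ℕ, ∀ x (j : Fin (2 * n)), x ∈ W.row j → ρ x = j.val := by
  classical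
  refine ⟨fun x => if h : ∃ j : Fin (2 * n), x ∈ W.row j then h.choose.val else 0, ?_⟩
  intro x j hx
  have h : ∃ j : Fin (2 * n), x ∈ W.row j := ⟨j, hx⟩
  simp only [h, dite_true]
  rw [W.row_unique h.choose_spec hx]

/-- A set of nails in columns that meet `X`, whose rows are determined by the column, a vertex of
`X`, and one of seven possibilities, has at most `14 * |X| ^ 2` elements. -/
theorem card_nails_le {f : Fin n → Fin (2 * n) → Bool → V} {X T : Finset V}
    (val : Fin n → V → Fin 7 → ℕ)
    (h : ∀ v ∈ T, ∃ x₁ ∈ X, ∃ x₂ ∈ X, ∃ m b i j, f i j b = v ∧ x₁ ∈ W.col i ∧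
      j.val = val i x₂ m) : T.card ≤ 14 * X.card ^ 2 := by
  have h' : ∀ v : T, ∃ d : V × V × Fin 7 × Bool, d.1 ∈ X ∧ d.2.1 ∈ X ∧ ∃ i j,
      f i j d.2.2.2 = v ∧ d.1 ∈ W.col i ∧ j.val = val i d.2.1 d.2.2.1 := by
    intro v
    obtain ⟨x₁, h1, x₂, h2, m, b, i, j, h3, h4, h5⟩ := h v v.2
    exact ⟨(x₁, x₂, m, b), h1, h2, i, j, h3, h4, h5⟩
  choose d hd1 hd2 i j hf hc hj using h'
  have := Finset.card_le_card_of_injOn (s := T.attach)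
    (t := X ×ˢ X ×ˢ (Finset.univ : Finset (Fin 7)) ×ˢ (Finset.univ : Finset Bool)) d
    (fun v _ => by simp [hd1, hd2]) (by
      intro v _ w _ heq
      have hi : i v = i w := W.col_unique (hc v) (heq ▸ hc w)
      have hjj : j v = j w := Fin.ext (by rw [hj, hj, hi, heq])
      exact Subtype.ext (by rw [← hf v, ← hf w, hi, hjj, heq]))
  simp only [Finset.card_attach, Finset.card_product, Finset.card_univ, Fintype.card_fin,
    Fintype.card_bool] at this
  calc T.card ≤ _ := this
    _ = _ := by ring

/-- Let a cut-off nail lie on column `i` and row `j`. Column `i` meets `X`, by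
`exists_reach_to_col`. One of the rows `j + 1`, `j + 2` runs towards column `i₀`, so `X` meets that
row or the stretch of column `i` leading to it. This makes `j` the row index of a vertex of `X`
minus 1 or 2, or its height minus 0, 1 or 2. The last two rows, which may lack such a successor,
account for the other two of the seven values. -/
theorem card_nails_not_reach_to_col {X : Finset V} (hX : X.card < n) (i₀ : Fin n) {T : Finset V}
    (hT : ∀ v ∈ T, v ∈ W.nails ∧ ∀ y ∈ W.col i₀, ¬ Reach W.toDigraph.Adj (X : Set V)ᶜ v y) :
    T.card ≤ 14 * X.card ^ 2 := by
  obtain ⟨f, hf⟩ := W.exists_nail_parametrization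
  obtain ⟨ρ, hρ⟩ := W.exists_rowIndex
  choose τ hτ using W.exists_height
  refine W.card_nails_le (f := f) (fun i x =>
    ![ρ x - 1, ρ x - 2, τ i x, τ i x - 1, τ i x - 2, 2 * n - 1, 2 * n - 2]) ?_
  intro v hv
  obtain ⟨hnail, hreach⟩ := hT v hv
  obtain ⟨i, j, b, hfv, hvi, hvj⟩ := hf v hnail
  obtain ⟨x₁, hx₁, hx₁X⟩ : ∃ x ∈ W.col i, x ∈ X := by
    by_contra! hfree
    obtain ⟨y, hy, h⟩ := W.exists_reach_to_col hX hfree hvi i₀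
    exact hreach y hy h
  obtain ⟨s, hs⟩ := List.mem_iff_getElem?.mp hvi
  suffices h : ∃ x₂ ∈ X, ∃ m : Fin 7, j.val =
      ![ρ x₂ - 1, ρ x₂ - 2, τ i x₂, τ i x₂ - 1, τ i x₂ - 2, 2 * n - 1, 2 * n - 2] m by
    obtain ⟨x₂, hx₂, m, hm⟩ := h
    exact ⟨x₁, hx₁X, x₂, hx₂, m, b, i, j, hfv, hx₁, hm⟩
  by_cases hvX : v ∈ X
  · refine ⟨v, hvX, 2, ?_⟩
    have := hτ i v j j s s s v v le_rfl le_rfl hs hs hs hvj hvj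
    exact le_antisymm this.1 this.2
  have hne : i ≠ i₀ := by
    rintro rfl
    exact hreach v hvi (Reach.refl (by simpa using hvX))
  have hj2 := j.2
  by_cases hj : 2 * n ≤ j.val + 2
  · by_cases h1 : j.val + 1 = 2 * n
    · exact ⟨x₁, hx₁X, 5, by simp; omega⟩
    · exact ⟨x₁, hx₁X, 6, by simp; omega⟩
  obtain ⟨j', hj', hdir⟩ : ∃ j' : Fin (2 * n), (j'.val = j.val + 1 ∨ j'.val = j.val + 2) ∧
      ((i < i₀ ∧ Even j'.val) ∨ (i₀ < i ∧ Odd j'.val)) := by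
    rcases lt_or_gt_of_ne hne with h | h
    · rcases Nat.even_or_odd j.val with hp | hp
      · exact ⟨⟨j + 2, by omega⟩, by simp, .inl ⟨h, by simpa [Nat.even_add] using hp⟩⟩
      · exact ⟨⟨j + 1, by omega⟩, by simp, .inl ⟨h, by simpa [Nat.even_add_one] using hp⟩⟩
    · rcases Nat.even_or_odd j.val with hp | hp
      · exact ⟨⟨j + 1, by omega⟩, by simp, .inr ⟨h, by simpa [Nat.odd_add_one] using hp⟩⟩
      · exact ⟨⟨j + 2, by omega⟩, by simp, .inr ⟨h, by simpa [Nat.odd_add] using hp⟩⟩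
  by_cases hrow : ∃ x ∈ W.row j', x ∈ X
  · obtain ⟨x₂, hx₂, hx₂X⟩ := hrow
    have := hρ x₂ j' hx₂
    rcases hj' with h | h
    · exact ⟨x₂, hx₂X, 0, by simp; omega⟩
    · exact ⟨x₂, hx₂X, 1, by simp; omega⟩
  obtain ⟨z, hzi, hzj⟩ := W.exists_mem_inter i j'
  obtain ⟨t, ht⟩ := List.mem_iff_getElem?.mp hzi
  have hst : s < t := W.col_order i j j' (by rw [Fin.lt_def]; omega) s t v z hs ht hvj hzj
  by_cases harc : ∃ p x, s ≤ p ∧ p ≤ t ∧ (W.col i)[p]? = some x ∧ x ∈ X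
  · obtain ⟨p, x₂, hsp, hpt, hx₂, hx₂X⟩ := harc
    obtain ⟨h1, h2⟩ := hτ i x₂ j j' s p t v z hsp hpt hs hx₂ ht hvj hzj
    obtain h | h | h : τ i x₂ = j.val ∨ τ i x₂ = j.val + 1 ∨ τ i x₂ = j.val + 2 := by omega
    · exact ⟨x₂, hx₂X, 2, by simp; omega⟩
    · exact ⟨x₂, hx₂X, 3, by simp; omega⟩
    · exact ⟨x₂, hx₂X, 4, by simp; omega⟩
  push Not at hrow harc
  obtain ⟨y, hyi, hyj⟩ := W.exists_mem_inter i₀ j'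
  refine absurd ?_ (hreach y hyi)
  have hadj : ∀ e ∈ pathEdges (W.col i), W.toDigraph.Adj e.1 e.2 := fun e he =>
    W.adj_of_col e (mem_cycleEdges.mpr (.inl (mem_pathEdges.mp he)))
  exact (Reach.of_path hadj hst.le hs ht fun p x h1 h2 h3 => by
    simpa using harc p x h1 h2 h3).trans
    (W.reach_along_row hzi hzj hyi hyj hdir (by simpa using hrow))

/-- The mirror image: arrive along row `j - 1` or `j - 2`, and treat the first two rows as
exceptional. -/
theorem card_nails_not_reach_from_col {X : Finset V} (hX : X.card < n) (i₀ : Fin n) {T : Finset V}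
    (hT : ∀ v ∈ T, v ∈ W.nails ∧ ∀ y ∈ W.col i₀, ¬ Reach W.toDigraph.Adj (X : Set V)ᶜ y v) :
    T.card ≤ 14 * X.card ^ 2 := by
  obtain ⟨f, hf⟩ := W.exists_nail_parametrization
  obtain ⟨ρ, hρ⟩ := W.exists_rowIndex
  choose τ hτ using W.exists_height
  refine W.card_nails_le (f := f) (fun i x =>
    ![ρ x + 1, ρ x + 2, τ i x, τ i x + 1, τ i x + 2, 0, 1]) ?_
  intro v hv
  obtain ⟨hnail, hreach⟩ := hT v hv
  obtain ⟨i, j, b, hfv, hvi, hvj⟩ := hf v hnail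
  obtain ⟨x₁, hx₁, hx₁X⟩ : ∃ x ∈ W.col i, x ∈ X := by
    by_contra! hfree
    obtain ⟨y, hy, h⟩ := W.exists_reach_from_col hX hfree hvi i₀
    exact hreach y hy h
  obtain ⟨s, hs⟩ := List.mem_iff_getElem?.mp hvi
  suffices h : ∃ x₂ ∈ X, ∃ m : Fin 7, j.val =
      ![ρ x₂ + 1, ρ x₂ + 2, τ i x₂, τ i x₂ + 1, τ i x₂ + 2, 0, 1] m by
    obtain ⟨x₂, hx₂, m, hm⟩ := h
    exact ⟨x₁, hx₁X, x₂, hx₂, m, b, i, j, hfv, hx₁, hm⟩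
  by_cases hvX : v ∈ X
  · refine ⟨v, hvX, 2, ?_⟩
    have := hτ i v j j s s s v v le_rfl le_rfl hs hs hs hvj hvj
    exact le_antisymm this.1 this.2
  have hne : i ≠ i₀ := by
    rintro rfl
    exact hreach v hvi (Reach.refl (by simpa using hvX))
  have hj2 := j.2
  by_cases hj : j.val < 2
  · by_cases h1 : j.val = 0
    · exact ⟨x₁, hx₁X, 5, by simp; omega⟩
    · exact ⟨x₁, hx₁X, 6, by simp; omega⟩
  obtain ⟨j', hj', hdir⟩ : ∃ j' : Fin (2 * n), (j'.val + 1 = j.val ∨ j'.val + 2 = j.val) ∧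
      ((i₀ < i ∧ Even j'.val) ∨ (i < i₀ ∧ Odd j'.val)) := by
    obtain ⟨m, hm⟩ : ∃ m, j.val = m + 2 := ⟨j.val - 2, by omega⟩
    rcases lt_or_gt_of_ne hne with h | h
    · rcases Nat.even_or_odd m with hp | hp
      · exact ⟨⟨m + 1, by omega⟩, by simp; omega, .inr ⟨h, by simpa [Nat.odd_add_one] using hp⟩⟩
      · exact ⟨⟨m, by omega⟩, by simp; omega, .inr ⟨h, hp⟩⟩
    · rcases Nat.even_or_odd m with hp | hp
      · exact ⟨⟨m, by omega⟩, by simp; omega, .inl ⟨h, hp⟩⟩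
      · exact ⟨⟨m + 1, by omega⟩, by simp; omega, .inl ⟨h, by simpa [Nat.even_add_one] using hp⟩⟩
  by_cases hrow : ∃ x ∈ W.row j', x ∈ X
  · obtain ⟨x₂, hx₂, hx₂X⟩ := hrow
    have := hρ x₂ j' hx₂
    rcases hj' with h | h
    · exact ⟨x₂, hx₂X, 0, by simp; omega⟩
    · exact ⟨x₂, hx₂X, 1, by simp; omega⟩
  obtain ⟨z, hzi, hzj⟩ := W.exists_mem_inter i j'
  obtain ⟨t, ht⟩ := List.mem_iff_getElem?.mp hzi
  have hst : t < s := W.col_order i j' j (by rw [Fin.lt_def]; omega) t s z v ht hs hzj hvj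
  by_cases harc : ∃ p x, t ≤ p ∧ p ≤ s ∧ (W.col i)[p]? = some x ∧ x ∈ X
  · obtain ⟨p, x₂, hsp, hpt, hx₂, hx₂X⟩ := harc
    obtain ⟨h1, h2⟩ := hτ i x₂ j' j t p s z v hsp hpt ht hx₂ hs hzj hvj
    obtain h | h | h : τ i x₂ = j.val ∨ τ i x₂ + 1 = j.val ∨ τ i x₂ + 2 = j.val := by omega
    · exact ⟨x₂, hx₂X, 2, by simp; omega⟩
    · exact ⟨x₂, hx₂X, 3, by simp; omega⟩
    · exact ⟨x₂, hx₂X, 4, by simp; omega⟩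
  push Not at hrow harc
  obtain ⟨y, hyi, hyj⟩ := W.exists_mem_inter i₀ j'
  refine absurd ?_ (hreach y hyi)
  have hadj : ∀ e ∈ pathEdges (W.col i), W.toDigraph.Adj e.1 e.2 := fun e he =>
    W.adj_of_col e (mem_cycleEdges.mpr (.inl (mem_pathEdges.mp he)))
  exact (W.reach_along_row hyi hyj hzi hzj hdir (by simpa using hrow)).trans
    (Reach.of_path hadj hst.le ht hs fun p x h1 h2 h3 => by simpa using harc p x h1 h2 h3)

end CylindricalWall

/-! ### Regions and the rows crossing them -/

namespace CylindricalWall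

variable {n : ℕ} (W : CylindricalWall V n)

/-- Position `t` of row `j` lies between two vertices of columns of the `b`-th block of `k`
consecutive columns. -/
def Bracketed (k b : ℕ) (j : Fin (2 * n)) (t : ℕ) : Prop :=
  ∃ (s u : ℕ) (x y : V) (i i' : Fin n), s ≤ t ∧ t ≤ u ∧ (W.row j)[s]? = some x ∧
    (W.row j)[u]? = some y ∧ x ∈ W.col i ∧ y ∈ W.col i' ∧ i.val / k = b ∧ i'.val / k = b

/-- The part of the wall spanned by the `b`-th block of `k` consecutive columns. -/
def region (k b : ℕ) : Set V :=
  {v | (∃ i : Fin n, i.val / k = b ∧ v ∈ W.col i) ∨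
    ∃ j t, (W.row j)[t]? = some v ∧ W.Bracketed k b j t}

variable {W} {k b b' : ℕ} {v : V}

theorem mem_region_of_mem_col {i : Fin n} (hv : v ∈ W.col i) : v ∈ W.region k (i.val / k) :=
  .inl ⟨i, rfl, hv⟩

theorem Bracketed.of_mem_region {j : Fin (2 * n)} {t : ℕ} (hv : v ∈ W.region k b)
    (ht : (W.row j)[t]? = some v) : W.Bracketed k b j t := by
  rcases hv with ⟨i, hi, hv⟩ | ⟨j', t', ht', h⟩
  · exact ⟨t, t, v, v, i, i, le_rfl, le_rfl, ht, ht, hv, hv, hi, hi⟩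
  · obtain rfl := W.row_unique (List.mem_of_getElem? ht) (List.mem_of_getElem? ht')
    obtain rfl := getElem?_inj_of_nodup (W.row_nodup j) ht ht'
    exact h

/-- A row meets all columns of one block before all those of the other, so the two brackets cannot
overlap. -/
theorem Bracketed.not_of_lt {j : Fin (2 * n)} {t : ℕ} (h : W.Bracketed k b j t)
    (h' : W.Bracketed k b' j t) : ¬ b < b' := by
  intro hlt
  obtain ⟨s, u, x, y, i, i', hst, htu, hx, hy, hxi, hyi, hi, hi'⟩ := h
  obtain ⟨s', u', x', y', l, l', hst', htu', hx', hy', hxl, hyl, hl, hl'⟩ := h'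
  have key : ∀ a a' : Fin n, a.val / k = b → a'.val / k = b' → a < a' := by
    intro a a' ha ha'
    by_contra hle
    have := Nat.div_le_div_right (c := k) (Fin.le_def.mp (not_lt.mp hle))
    omega
  rcases Nat.even_or_odd j.val with hj | hj
  · have := W.row_order_fwd j hj i' l (key _ _ hi' hl) u s' y x' hy hx' hyi hxl
    omega
  · have := W.row_order_bwd j hj i l' (key _ _ hi hl') u' s y' x hy' hx hyl hxi
    omega

theorem region_unique (h : v ∈ W.region k b) (h' : v ∈ W.region k b') : b = b' := by
  by_cases hrow : ∃ (j : Fin (2 * n)) (t : ℕ), (W.row j)[t]? = some v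
  · obtain ⟨j, t, ht⟩ := hrow
    have h1 := Bracketed.of_mem_region h ht
    have h2 := Bracketed.of_mem_region h' ht
    exact le_antisymm (not_lt.mp (h2.not_of_lt h1)) (not_lt.mp (h1.not_of_lt h2))
  · push Not at hrow
    rcases h with ⟨i, hi, hv⟩ | ⟨j, t, ht, -⟩
    · rcases h' with ⟨i', hi', hv'⟩ | ⟨j, t, ht, -⟩
      · rw [← hi, ← hi', W.col_unique hv hv']
      · exact absurd ht (hrow j t)
    · exact absurd ht (hrow j t)

/-- A row meets a region in an interval. -/
theorem mem_region_of_between {j : Fin (2 * n)} {s t u : ℕ} {x y : V} (hx : x ∈ W.region k b)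
    (hy : y ∈ W.region k b) (hs : (W.row j)[s]? = some x) (hu : (W.row j)[u]? = some y)
    (ht : (W.row j)[t]? = some v) (hst : s ≤ t) (htu : t ≤ u) : v ∈ W.region k b := by
  obtain ⟨s', -, x', -, i, -, h1, -, h2, -, h3, -, h4, -⟩ := Bracketed.of_mem_region hx hs
  obtain ⟨-, u', -, y', -, i', -, h1', -, h2', -, h3', -, h4'⟩ := Bracketed.of_mem_region hy hu
  exact .inr ⟨j, t, ht, s', u', x', y', i, i', by omega, by omega, h2, h2', h3, h3', h4, h4'⟩

theorem exists_reach_col_of_mem_region (hv : v ∈ W.region k b) :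
    ∃ i : Fin n, i.val / k = b ∧ ∃ y ∈ W.col i, Reach W.toDigraph.Adj (W.region k b) v y := by
  rcases hv with ⟨i, rfl, hv⟩ | ⟨j, t, ht, s, u, x, y, i, i', hst, htu, hx, hy, hxi, hyi, hi, hi'⟩
  · exact ⟨i, rfl, v, hv, Reach.refl (mem_region_of_mem_col hv)⟩
  · have hxR : x ∈ W.region k b := hi ▸ mem_region_of_mem_col hxi
    have hyR : y ∈ W.region k b := hi' ▸ mem_region_of_mem_col hyi
    exact ⟨i', hi', y, hyi, Reach.of_path W.adj_of_row htu ht hy fun p z h1 h2 hz =>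
      mem_region_of_between hxR hyR hx hy hz (by omega) h2⟩

theorem exists_col_reach_of_mem_region (hv : v ∈ W.region k b) :
    ∃ i : Fin n, i.val / k = b ∧ ∃ y ∈ W.col i, Reach W.toDigraph.Adj (W.region k b) y v := by
  rcases hv with ⟨i, rfl, hv⟩ | ⟨j, t, ht, s, u, x, y, i, i', hst, htu, hx, hy, hxi, hyi, hi, hi'⟩
  · exact ⟨i, rfl, v, hv, Reach.refl (mem_region_of_mem_col hv)⟩
  · have hxR : x ∈ W.region k b := hi ▸ mem_region_of_mem_col hxi
    have hyR : y ∈ W.region k b := hi' ▸ mem_region_of_mem_col hyi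
    exact ⟨i, hi, x, hxi, Reach.of_path W.adj_of_row hst hx ht fun p z h1 h2 hz =>
      mem_region_of_between hxR hyR hx hy hz h1 (by omega)⟩

theorem exists_reach_to_col_of_region {X : Finset V} (hX : X.card < n)
    (hv : v ∈ W.region k b) (hR : ∀ x ∈ W.region k b, x ∉ X) (i' : Fin n) :
    ∃ y ∈ W.col i', Reach W.toDigraph.Adj (X : Set V)ᶜ v y := by
  obtain ⟨i, rfl, y, hy, h⟩ := exists_reach_col_of_mem_region hv
  obtain ⟨z, hz, h'⟩ := W.exists_reach_to_col hX
    (fun x hx => hR x (mem_region_of_mem_col hx)) hy i'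
  exact ⟨z, hz, (h.mono_set fun x hx => by simpa using hR x hx).trans h'⟩

theorem exists_reach_from_col_of_region {X : Finset V} (hX : X.card < n)
    (hv : v ∈ W.region k b) (hR : ∀ x ∈ W.region k b, x ∉ X) (i' : Fin n) :
    ∃ y ∈ W.col i', Reach W.toDigraph.Adj (X : Set V)ᶜ y v := by
  obtain ⟨i, rfl, y, hy, h⟩ := exists_col_reach_of_mem_region hv
  obtain ⟨z, hz, h'⟩ := W.exists_reach_from_col hX
    (fun x hx => hR x (mem_region_of_mem_col hx)) hy i'
  exact ⟨z, hz, h'.trans (h.mono_set fun x hx => by simpa using hR x hx)⟩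

variable (W) in
/-- Row `j` leaves the region at `u`. -/
def IsExit (k b : ℕ) (j : Fin (2 * n)) (u : V) : Prop :=
  u ∈ W.region k b ∧ ∃ (p : ℕ) (y : V), (W.row j)[p]? = some u ∧ (W.row j)[p + 1]? = some y ∧
    y ∉ W.region k b

variable (W) in
/-- Row `j` enters the region at `w`. -/
def IsEntry (k b : ℕ) (j : Fin (2 * n)) (w : V) : Prop :=
  w ∈ W.region k b ∧ ∃ (p : ℕ) (y : V), (W.row j)[p]? = some y ∧ (W.row j)[p + 1]? = some w ∧
    y ∉ W.region k b

/-- A row meets the region in an interval, so it leaves only once. -/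
theorem IsExit.unique {j : Fin (2 * n)} {u u' : V} (h : W.IsExit k b j u)
    (h' : W.IsExit k b j u') : u = u' := by
  obtain ⟨hu, p, y, hp, hy, hyR⟩ := h
  obtain ⟨hu', p', y', hp', hy', hyR'⟩ := h'
  rcases lt_trichotomy p p' with hlt | rfl | hlt
  · exact absurd (mem_region_of_between hu hu' hp hp' hy (by omega) hlt) hyR
  · simpa using hp.symm.trans hp'
  · exact absurd (mem_region_of_between hu' hu hp' hp hy' (by omega) hlt) hyR'

theorem IsEntry.unique {j : Fin (2 * n)} {u u' : V} (h : W.IsEntry k b j u)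
    (h' : W.IsEntry k b j u') : u = u' := by
  obtain ⟨hu, p, y, hy, hp, hyR⟩ := h
  obtain ⟨hu', p', y', hy', hp', hyR'⟩ := h'
  rcases lt_trichotomy p p' with hlt | rfl | hlt
  · exact absurd (mem_region_of_between hu hu' hp hp' hy' (by omega) (by omega)) hyR'
  · simpa using hp.symm.trans hp'
  · exact absurd (mem_region_of_between hu' hu hp' hp hy (by omega) (by omega)) hyR

/-- From the entry of one row one can reach the exit of another row inside the region along the
first row, any column of the region, and the second row. -/
theorem reach_exit_of_entry {j j' : Fin (2 * n)} {i : Fin n} (hi : i.val / k = b) {u w : V}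
    (hu : W.IsExit k b j u) (hw : W.IsEntry k b j' w) :
    Reach W.toDigraph.Adj {v | v ∈ W.region k b ∧ ((v ∈ W.row j ∨ v ∈ W.row j') ∨ v ∈ W.col i)}
      w u := by
  obtain ⟨huR, p, y, hp, hy, hyR⟩ := hu
  obtain ⟨hwR, p', y', hy', hp', hyR'⟩ := hw
  obtain ⟨z, hzi, hzj⟩ := W.exists_mem_inter i j
  obtain ⟨z', hzi', hzj'⟩ := W.exists_mem_inter i j'
  have hzR : z ∈ W.region k b := hi ▸ mem_region_of_mem_col hzi
  have hzR' : z' ∈ W.region k b := hi ▸ mem_region_of_mem_col hzi'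
  obtain ⟨s, hs⟩ := List.mem_iff_getElem?.mp hzj
  obtain ⟨s', hs'⟩ := List.mem_iff_getElem?.mp hzj'
  -- If the row met the column after the exit, the vertex following the exit would lie in the
  -- region.
  have h1 : s ≤ p := by
    by_contra hlt
    exact hyR (mem_region_of_between huR hzR hp hs hy (by omega) (by omega))
  have h2 : p' + 1 ≤ s' := by
    by_contra hlt
    exact hyR' (mem_region_of_between hzR' hwR hs' hp' hy' (by omega) (by omega))
  refine Reach.trans (v := z') ?_ (Reach.trans (v := z) ?_ ?_)
  · exact Reach.of_path W.adj_of_row h2 hp' hs' fun q x hq1 hq2 hx =>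
      ⟨mem_region_of_between hwR hzR' hp' hs' hx hq1 hq2, .inl (.inr (List.mem_of_getElem? hx))⟩
  · refine Reach.of_cycle W.adj_of_col (fun x hx => ?_) hzi' hzi
    exact ⟨hi ▸ mem_region_of_mem_col hx, .inr hx⟩
  · exact Reach.of_path W.adj_of_row h1 hs hp fun q x hq1 hq2 hx =>
      ⟨mem_region_of_between hzR huR hs hp hx hq1 hq2, .inl (.inl (List.mem_of_getElem? hx))⟩

end CylindricalWall

/-! ### Selecting independent indices and lifting walks -/

/-- Greedy choice: by injectivity an index conflicts with at most one other in each direction, so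
each choice discards at most three indices, itself included. -/
theorem exists_independent_indices {ι β : Type*} {f g : ι → β} (hf : Function.Injective f)
    (hg : Function.Injective g) (k : ℕ) :
    ∀ s : Finset ι, 3 * k ≤ s.card →
      ∃ e : Fin k → ι, (∀ a, e a ∈ s) ∧ Function.Injective e ∧
        ∀ a a', a ≠ a' → f (e a) ≠ g (e a') := by
  classical
  induction k with
  | zero => exact fun s _ => ⟨Fin.elim0, fun a => a.elim0, fun a => a.elim0, fun a => a.elim0⟩
  | succ k ih =>
    intro s hs
    obtain ⟨i, hi⟩ : s.Nonempty := Finset.card_pos.mp (by omega)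
    let b1 := s.filter fun x => g x = f i
    let b2 := s.filter fun x => f x = g i
    have h1 : b1.card ≤ 1 := Finset.card_le_one.mpr fun x hx y hy => hg (by
      simp only [b1, Finset.mem_filter] at hx hy
      rw [hx.2, hy.2])
    have h2 : b2.card ≤ 1 := Finset.card_le_one.mpr fun x hx y hy => hf (by
      simp only [b2, Finset.mem_filter] at hx hy
      rw [hx.2, hy.2])
    have hcard : 3 * k ≤ (((s \ {i}) \ b1) \ b2).card := by
      have e1 := Finset.le_card_sdiff {i} s
      have e2 := Finset.le_card_sdiff b1 (s \ {i})
      have e3 := Finset.le_card_sdiff b2 ((s \ {i}) \ b1)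
      rw [Finset.card_singleton] at e1
      omega
    obtain ⟨e, he, hinj, hne⟩ := ih _ hcard
    have hmem : ∀ a, e a ∈ s ∧ e a ≠ i ∧ g (e a) ≠ f i ∧ f (e a) ≠ g i := by
      intro a
      have := he a
      simp only [b1, b2, Finset.mem_sdiff, Finset.mem_filter, Finset.mem_singleton, not_and] at this
      exact ⟨this.1.1.1, this.1.1.2, this.1.2 this.1.1.1, this.2 this.1.1.1⟩
    refine ⟨Fin.cons i e, ?_, ?_, ?_⟩
    · intro a
      refine Fin.cases ?_ (fun a => ?_) a
      · simpa using hi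
      · simpa using (hmem a).1
    · rw [Fin.cons_injective_iff]
      refine ⟨?_, hinj⟩
      rintro ⟨a, ha⟩
      exact (hmem a).2.1 ha
    · intro a a'
      refine Fin.cases ?_ (fun a => ?_) a <;> refine Fin.cases ?_ (fun a' => ?_) a'
      · simp
      · intro _
        simpa using (hmem a').2.2.1.symm
      · intro _
        simpa using (hmem a).2.2.2
      · intro h
        simpa using hne a a' (fun h' => h (by rw [h']))

/-- A stretch of a path lifts to the double cover. -/
theorem Reach.of_path_doubleCover {r : V → V → Prop} {l : List V} {S : Set (V × Bool)} {s t : ℕ}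
    (hst : s ≤ t) (hr : ∀ p x y, s ≤ p → p + 1 ≤ t → l[p]? = some x → l[p + 1]? = some y → r x y)
    {u v : V} (hu : l[s]? = some u) (hv : l[t]? = some v)
    (hS : ∀ p x, s ≤ p → p ≤ t → l[p]? = some x → (x, p.bodd) ∈ S) :
    Reach (doubleCover r) S (u, s.bodd) (v, t.bodd) := by
  induction t, hst using Nat.le_induction generalizing v with
  | base =>
    obtain rfl : u = v := by simpa using hu.symm.trans hv
    exact Reach.refl (hS s u le_rfl le_rfl hu)
  | succ t hst ih =>
    have ht : t < l.length := by have := (List.getElem?_eq_some_iff.mp hv).1; omega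
    have hw := List.getElem?_eq_getElem ht
    refine (ih (fun p x y h1 h2 => hr p x y h1 (by omega)) hw
      fun i x h1 h2 => hS i x h1 (by omega)).trans (Reach.single ?_
      (hS t _ hst (by omega) hw) (hS _ _ (by omega) le_rfl hv))
    exact ⟨hr t _ _ hst le_rfl hw hv, by simp [Nat.bodd_succ]⟩

/-- A walk in a graph with a proper 2-colouring lifts to the double cover. -/
theorem Reach.lift {r r' : V → V → Prop} {χ : V → Bool} (hχ : ∀ u v, r u v → χ v = !χ u)
    (hr : ∀ u v, r u v → r' u v) {S : Set V} {u v : V} (h : Reach r S u v) (ε : Bool)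
    {S' : Set (V × Bool)} (hS : ∀ x ∈ S, (x, xor (χ x) ε) ∈ S') :
    Reach (doubleCover r') S' (u, xor (χ u) ε) (v, xor (χ v) ε) := by
  refine Reach.head_induction
    (P := fun u => Reach (doubleCover r') S' (u, xor (χ u) ε) (v, xor (χ v) ε)) h
    (fun hv => Reach.refl (hS v hv)) fun a c hac ha hc ih => ?_
  exact (Reach.single ⟨hr _ _ hac, by simp [hχ a c hac]⟩ (hS a ha) (hS c hc.left_mem)).trans ih

/-! ### Closing a linkage to odd cycles -/

namespace CylindricalWall

variable {n : ℕ} {W : CylindricalWall V n} {k b : ℕ} {χ : V → Bool} {H : V → V → Prop}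

/-- A walk in the double cover between the two lifts of a region contains a walk between them that
leaves the region through a row, returns through a row, and avoids it in between. -/
theorem exists_jump (hχ : ∀ u v, W.toDigraph.Adj u v → χ v = !χ u)
    (hH : ∀ u v, H u v → u ∈ W.region k b ∨ v ∈ W.region k b → W.toDigraph.Adj u v)
    {S : Set (V × Bool)} {u w : V} (hu : u ∈ W.region k b) (hw : w ∈ W.region k b)
    (h : Reach (doubleCover H) S (u, χ u) (w, !χ w)) :
    ∃ S' ⊆ S, ∃ u' w' j j', W.IsExit k b j u' ∧ W.IsEntry k b j' w' ∧ (u', χ u') ∈ S ∧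
      (w', !χ w') ∈ S ∧ (∀ p ∈ S', p.1 ∈ W.region k b → p.1 = u' ∨ p.1 = w') ∧
      Reach (doubleCover H) S' (u', χ u') (w', !χ w') := by
  -- Cut at the last visit to the `χ`-lift of the region, then at the first later visit to the other
  -- lift.
  obtain ⟨S₁, hS₁, t, ⟨htR, ht⟩, hint, h₁, -⟩ := h.exists_last
    (T := {p | p.1 ∈ W.region k b ∧ p.2 = χ p.1}) ⟨hu, rfl⟩
  obtain ⟨S₂, hS₂, t', ⟨htR', ht'⟩, hint', h₂, -⟩ := h₁.exists_first
    (T := {p | p.1 ∈ W.region k b ∧ p.2 = !χ p.1}) ⟨hw, rfl⟩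
  obtain ⟨u', ε⟩ := t
  obtain ⟨w', ε'⟩ := t'
  simp only at htR htR' ht ht'
  subst ht ht'
  have hadj : ∀ p ∈ S₂, p.1 ∈ W.region k b → p = (u', χ u') ∨ p = (w', !χ w') := by
    intro p hp hpR
    by_cases hc : p.2 = χ p.1
    · exact .inl (hint ⟨hS₂ hp, hpR, hc⟩)
    · exact .inr (hint' ⟨hp, hpR, by cases h1 : p.2 <;> cases h2 : χ p.1 <;> simp_all⟩)
  have hne : (u', χ u') ≠ (w', !χ w') := by
    intro heq
    simp only [Prod.mk.injEq] at heq
    obtain ⟨rfl, h⟩ := heq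
    simp at h
  have hrow : ∀ x y, W.toDigraph.Adj x y →
      ¬ (x ∈ W.region k b ∧ y ∈ W.region k b) → x ∈ W.region k b ∨ y ∈ W.region k b →
      ∃ j, (x, y) ∈ pathEdges (W.row j) := by
    intro x y hxy hnot hor
    rcases hxy with ⟨i, hi⟩ | hj
    · obtain ⟨hx, hy⟩ := mem_of_mem_cycleEdges hi
      refine absurd ?_ hnot
      have hxR := mem_region_of_mem_col (k := k) hx
      have hyR := mem_region_of_mem_col (k := k) hy
      rcases hor with h | h
      · rw [region_unique h hxR]; exact ⟨hxR, hyR⟩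
      · rw [region_unique h hyR]; exact ⟨hxR, hyR⟩
    · exact hj
  obtain ⟨j, hexit⟩ : ∃ j, W.IsExit k b j u' := by
    rcases Relation.ReflTransGen.cases_head h₂.2 with heq | ⟨c, ⟨⟨hHc, hc⟩, -, hcS⟩, -⟩
    · exact absurd heq hne
    · have hWc := hH _ _ hHc (.inl htR)
      -- A step inside the region follows a wall edge and stays in the `χ`-lift, which is not
      -- visited again.
      have hcR : c.1 ∉ W.region k b := by
        intro hcR
        have hc1 : c = (u', χ u') := hint ⟨hS₂ hcS, hcR, by rw [hc, hχ _ _ hWc]⟩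
        exact W.ne_of_adj hWc (by rw [hc1])
      obtain ⟨j, hj⟩ := hrow _ _ hWc (fun h => hcR h.2) (.inl htR)
      obtain ⟨p, hp, hp'⟩ := mem_pathEdges.mp hj
      exact ⟨j, htR, p, c.1, hp, hp', hcR⟩
  obtain ⟨j', hentry⟩ : ∃ j, W.IsEntry k b j w' := by
    rcases Relation.ReflTransGen.cases_tail h₂.2 with heq | ⟨c, -, ⟨hHc, hc⟩, hcS, -⟩
    · exact absurd heq.symm hne
    · have hWc := hH _ _ hHc (.inr htR')
      have hcR : c.1 ∉ W.region k b := by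
        intro hcR
        have hc1 : c = (w', !χ w') := hint' ⟨hcS, hcR, by
          have := hχ _ _ hWc
          simp only at hc this
          rw [← Bool.not_not (b := c.2), ← hc, this]; simp⟩
        exact W.ne_of_adj hWc (by rw [hc1])
      obtain ⟨j, hj⟩ := hrow _ _ hWc (fun h => hcR h.1) (.inr htR')
      obtain ⟨p, hp, hp'⟩ := mem_pathEdges.mp hj
      exact ⟨j, htR', p, c.1, hp, hp', hcR⟩
  refine ⟨S₂, hS₂.trans hS₁, u', w', j, j', hexit, hentry, hS₁ (hS₂ h₂.left_mem),
    hS₁ (hS₂ h₂.right_mem), ?_, h₂⟩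
  intro p hp hpR
  rcases hadj p hp hpR with rfl | rfl
  · exact .inl rfl
  · exact .inr rfl

theorem encard_le_two_of_bool {ι : Type*} {I : Set ι} (P : ι → Bool → Prop)
    (hI : ∀ i ∈ I, ∃ ε, P i ε) (hP : ∀ ε i i', P i ε → P i' ε → i = i') : I.encard ≤ 2 := by
  have hsub : I ⊆ {i | P i false} ∪ {i | P i true} := by
    intro i hi
    obtain ⟨ε, h⟩ := hI i hi
    cases ε
    · exact .inl h
    · exact .inr h
  have h1 : ∀ ε, {i | P i ε}.encard ≤ 1 := fun ε =>
    Set.encard_le_one_iff.mpr fun i i' h h' => hP ε i i' h h'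
  calc I.encard ≤ _ := Set.encard_le_encard hsub
    _ ≤ _ := Set.encard_union_le _ _
    _ ≤ 1 + 1 := add_le_add (h1 _) (h1 _)
    _ = 2 := by norm_num

/-- Many disjoint walks in the double cover between the two lifts of a region can be closed up
inside the region to odd cycles. -/
theorem exists_oddCycles_of_linkage {G : Digraph V}
    (hχ : ∀ u v, W.toDigraph.Adj u v → χ v = !χ u)
    (hWG : W.toDigraph ≤ G) (hHG : ∀ u v, H u v → G.Adj u v)
    (hH : ∀ u v, H u v → u ∈ W.region k b ∨ v ∈ W.region k b → W.toDigraph.Adj u v)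
    (hb : (b + 1) * k ≤ n) {S : Fin (3 * k) → Set (V × Bool)}
    (hS : Pairwise fun i j => Disjoint (S i) (S j))
    (hreach : ∀ i, ∃ u ∈ W.region k b, ∃ w ∈ W.region k b,
      Reach (doubleCover H) (S i) (u, χ u) (w, !χ w)) :
    ∃ C : Fin k → List V, (∀ i, IsOddCycle G (C i)) ∧ IsHalfIntegralPacking C := by
  have hjump : ∀ i, ∃ S' ⊆ S i, ∃ u' w' j j', W.IsExit k b j u' ∧ W.IsEntry k b j' w' ∧
      (u', χ u') ∈ S i ∧ (w', !χ w') ∈ S i ∧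
      (∀ p ∈ S', p.1 ∈ W.region k b → p.1 = u' ∨ p.1 = w') ∧
      Reach (doubleCover H) S' (u', χ u') (w', !χ w') := by
    intro i
    obtain ⟨u, hu, w, hw, h⟩ := hreach i
    exact exists_jump hχ hH hu hw h
  choose S' hS' u w j j' hexit hentry huS hwS hmeet hr using hjump
  have hSinj : ∀ p i i', p ∈ S i → p ∈ S i' → i = i' := fun p i i' h h' => by
    by_contra hne
    exact Set.disjoint_left.mp (hS hne) h h'
  -- A row has only one exit, and its `χ`-lift lies on only one of the disjoint walks.
  have hj : Function.Injective j := fun i i' heq => by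
    have : u i = u i' := (hexit i).unique (heq ▸ hexit i')
    exact hSinj _ i i' (huS i) (this ▸ huS i')
  have hj' : Function.Injective j' := fun i i' heq => by
    have : w i = w i' := (hentry i).unique (heq ▸ hentry i')
    exact hSinj _ i i' (hwS i) (this ▸ hwS i')
  obtain ⟨e, -, he, hind⟩ := exists_independent_indices hj hj' k Finset.univ (by simp)
  have hcol : ∀ a : Fin k, b * k + a.val < n := fun a => by
    have := a.2
    have : (b + 1) * k = b * k + k := by ring
    omega
  -- The `k` columns of the region are handed out, one to each cycle.
  let κ : Fin k → Fin n := fun a => ⟨b * k + a.val, hcol a⟩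
  have hκ : ∀ a, (κ a).val / k = b := fun a => by
    have := a.2
    simp only [κ]
    rw [mul_comm, Nat.mul_add_div (by omega), Nat.div_eq_of_lt a.2, add_zero]
  let T : Fin k → Set (V × Bool) := fun a => {p | (p.1 ∉ W.region k b ∧ p ∈ S (e a)) ∨
    (p.1 ∈ W.region k b ∧
      ((p.1 ∈ W.row (j (e a)) ∨ p.1 ∈ W.row (j' (e a))) ∨ p.1 ∈ W.col (κ a)))}
  have hmem_exit : ∀ i, u i ∈ W.row (j i) := fun i => by
    obtain ⟨-, p, y, hp, -⟩ := hexit i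
    exact List.mem_of_getElem? hp
  have hmem_entry : ∀ i, w i ∈ W.row (j' i) := fun i => by
    obtain ⟨-, p, y, -, hp, -⟩ := hentry i
    exact List.mem_of_getElem? hp
  have hcyc : ∀ a, ∃ c, IsOddCycle G c ∧ ∀ v ∈ c, ∃ ε, (v, ε) ∈ T a := by
    intro a
    have h1 : Reach (doubleCover G.Adj) (T a) (u (e a), χ (u (e a))) (w (e a), !χ (w (e a))) := by
      refine (hr (e a)).mono (fun p _ q _ h => ⟨hHG _ _ h.1, h.2⟩) fun p hp => ?_
      by_cases hpR : p.1 ∈ W.region k b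
      · refine .inr ⟨hpR, .inl ?_⟩
        rcases hmeet (e a) p hp hpR with h | h
        · exact .inl (h ▸ hmem_exit _)
        · exact .inr (h ▸ hmem_entry _)
      · exact .inl ⟨hpR, hS' _ hp⟩
    -- The return inside the region is lifted to the second copy and ends at `(u, !χ u)`, the other
    -- lift of the starting vertex.
    have h2 := (reach_exit_of_entry (hκ a) (hexit (e a)) (hentry (e a))).lift hχ
      (r' := G.Adj) (fun x y h => hWG h) true (S' := T a) (fun x hx => .inr hx)
    simp only [Bool.xor_true] at h2
    exact exists_oddCycle_of_reach_doubleCover (h1.trans h2)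
  choose C hC hCT using hcyc
  refine ⟨C, hC, fun v => ?_⟩
  by_cases hv : v ∈ W.region k b
  -- Inside the region the Boolean tells use on a row from use on a column; outside, it is the lift.
  · refine encard_le_two_of_bool (fun a ε => if ε then v ∈ W.row (j (e a)) ∨ v ∈ W.row (j' (e a))
      else v ∈ W.col (κ a)) ?_ ?_
    · intro a ha
      obtain ⟨ε, h | h⟩ := hCT a v ha
      · exact absurd hv h.1
      · rcases h.2 with h | h
        · exact ⟨true, by simpa using h⟩
        · exact ⟨false, by simpa using h⟩
    · intro ε a a' h h'
      cases ε
      · simp only [Bool.false_eq_true, if_false] at h h'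
        have := W.col_unique h h'
        simpa [κ, Fin.ext_iff] using this
      · simp only [if_true] at h h'
        by_contra hne
        rcases h with h | h <;> rcases h' with h' | h'
        · exact hne (he (hj (W.row_unique h h')))
        · exact hind a a' hne (W.row_unique h h')
        · exact hind a' a (Ne.symm hne) (W.row_unique h' h)
        · exact hne (he (hj' (W.row_unique h h')))
  · refine encard_le_two_of_bool (fun a ε => (v, ε) ∈ S (e a)) ?_ ?_
    · intro a ha
      obtain ⟨ε, h | h⟩ := hCT a v ha
      · exact ⟨ε, h.2⟩
      · exact absurd h.1 hv
    · intro ε a a' h h'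
      exact he (hSinj _ _ _ h h')

end CylindricalWall

/-! ### From odd paths to a linkage -/

/-- The lift of position `p` of the path `l` to the double cover, relative to the lift of the
vertex given by the colouring `χ`. -/
def liftSign (χ : V → Bool) (l : List V) (p : ℕ) : Bool :=
  xor ((l[p]?.map χ).getD false) p.bodd

theorem xor_liftSign {χ : V → Bool} {l : List V} {p : ℕ} {v : V} (h : l[p]? = some v) :
    xor (χ v) (liftSign χ l p) = p.bodd := by
  simp [liftSign, h]

namespace CylindricalWall

variable {n : ℕ} (W : CylindricalWall V n)

/-- Position `p` of the path `l` lies in the region with index `c`. -/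
def Hits (k : ℕ) {q : ℕ} (l : List V) (p : ℕ) (c : Fin q) : Prop :=
  ∃ v, l[p]? = some v ∧ v ∈ W.region k c

variable {W} {k q : ℕ}

theorem Hits.unique {l : List V} {p : ℕ} {c c' : Fin q} (h : W.Hits k l p c)
    (h' : W.Hits k l p c') : c = c' := by
  obtain ⟨v, hv, hc⟩ := h
  obtain ⟨v', hv', hc'⟩ := h'
  obtain rfl : v = v' := by simpa using hv.symm.trans hv'
  exact Fin.ext (region_unique hc hc')

/-- Regions are disjoint, so each vertex of `X` spoils at most one label. -/
theorem exists_label_avoiding {X : Finset V} {T : Finset (Fin q)} (hT : X.card < T.card) :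
    ∃ c ∈ T, ∀ x ∈ W.region k c.val, x ∉ X := by
  by_contra! hcon
  choose x hxR hxX using hcon
  have := Finset.card_le_card_of_injOn (s := T.attach) (t := X) (fun c => x c c.2)
    (fun c _ => hxX c c.2) (by
      intro c _ c' _ heq
      dsimp only at heq
      exact Subtype.ext (Fin.ext (region_unique (hxR c c.2) (heq ▸ hxR c' c'.2))))
  rw [Finset.card_attach] at this
  omega

theorem card_meeting_le {ι : Type*} [Fintype ι] [DecidableEq V] {U : ι → List V}
    (hU : IsHalfIntegralPacking U) (X : Finset V) :
    (Finset.univ.filter fun i => ∃ x ∈ X, x ∈ U i).card ≤ X.card * 2 := by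
  classical
  have hsub : (Finset.univ.filter fun i => ∃ x ∈ X, x ∈ U i) ⊆
      X.biUnion fun x => Finset.univ.filter fun i => x ∈ U i := by
    intro i hi
    simpa using hi
  refine (Finset.card_le_card hsub).trans (Finset.card_biUnion_le_card_mul _ _ _ fun x _ => ?_)
  have h := hU x
  have heq : {i | x ∈ U i} = ((Finset.univ.filter fun i => x ∈ U i : Finset ι) : Set ι) := by
    ext i; simp
  rw [heq, Set.encard_coe_eq_coe_finsetCard] at h
  exact_mod_cast h

/-- Few vertices cannot separate the two lifts of a region in the double cover of the wall together
with suitable segments of many odd paths. -/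
theorem not_separates {h b : ℕ} (hk : 3 * k ≤ n) (hb : b * k < n) (hk0 : 1 ≤ k) {χ : V → Bool}
    (hχ : ∀ u v, W.toDigraph.Adj u v → χ v = !χ u) {H : V → V → Prop}
    (hWH : ∀ u v, W.toDigraph.Adj u v → H u v) {U : Fin h → List V}
    (hU : IsHalfIntegralPacking U) {s m t L : Fin h → ℕ} {a z : Fin h → V}
    (hUH : ∀ i p x y, s i ≤ p → p + 1 ≤ t i → (U i)[p]? = some x → (U i)[p + 1]? = some y → H x y)
    (hmt : ∀ i, m i ≤ t i) (htL : ∀ i, t i ≤ L i)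
    (ha : ∀ i, (U i)[0]? = some (a i)) (hz : ∀ i, (U i)[L i]? = some (z i))
    (hL : ∀ i, Odd (L i)) (hainj : Function.Injective a) (hzinj : Function.Injective z)
    (hanail : ∀ i, a i ∈ W.nails) (hznail : ∀ i, z i ∈ W.nails)
    (haχ : ∀ i, χ (a i) = false) (hzχ : ∀ i, χ (z i) = false)
    (hs : ∀ i, s i = 0 ∨ 3 * k ≤ (labelsOn (W.Hits k (q := q) (U i))
      (fun p => liftSign χ (U i) p = false) (s i) (m i)).card)
    (ht : ∀ i, t i = L i ∨ 3 * k ≤ (labelsOn (W.Hits k (q := q) (U i))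
      (fun p => liftSign χ (U i) p = true) (m i) (t i)).card)
    (hh : 6 * k + 252 * k ^ 2 ≤ h) {X : Finset (V × Bool)} (hX : X.card < 3 * k) :
    ¬ Separates (doubleCover H) {p | p.1 ∈ W.region k b ∧ p.2 = χ p.1}
      {p | p.1 ∈ W.region k b ∧ p.2 = !χ p.1} X := by
  classical
  intro hsep
  let Y : Finset V := X.image Prod.fst
  have hYX : Y.card ≤ X.card := Finset.card_image_le
  have hYn : Y.card < n := by omega
  have hlift : ∀ x ∈ (Y : Set V)ᶜ, ∀ ε, (x, ε) ∈ (X : Set (V × Bool))ᶜ := by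
    intro x hx ε hxX
    exact hx (Finset.mem_coe.mpr (Finset.mem_image.mpr ⟨(x, ε), hxX, rfl⟩))
  let i₀ : Fin n := ⟨b * k, hb⟩
  have hi₀ : ∀ y ∈ W.col i₀, y ∈ W.region k b := fun y hy => by
    have := mem_region_of_mem_col (k := k) hy
    simpa [i₀, Nat.mul_div_cancel b hk0] using this
  let B₁ : Finset (Fin h) := Finset.univ.filter fun i => ∃ x ∈ Y, x ∈ U i
  let B₂ : Finset (Fin h) := Finset.univ.filter fun i =>
    ∀ y ∈ W.col i₀, ¬ Reach W.toDigraph.Adj (Y : Set V)ᶜ y (a i)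
  let B₃ : Finset (Fin h) := Finset.univ.filter fun i =>
    ∀ y ∈ W.col i₀, ¬ Reach W.toDigraph.Adj (Y : Set V)ᶜ (z i) y
  have hB₁ : B₁.card ≤ Y.card * 2 := card_meeting_le hU Y
  have hB₂ : B₂.card ≤ 14 * Y.card ^ 2 := by
    rw [← Finset.card_image_of_injective _ hainj]
    refine W.card_nails_not_reach_from_col hYn i₀ fun v hv => ?_
    obtain ⟨i, hi, rfl⟩ := Finset.mem_image.mp hv
    exact ⟨hanail i, (Finset.mem_filter.mp hi).2⟩
  have hB₃ : B₃.card ≤ 14 * Y.card ^ 2 := by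
    rw [← Finset.card_image_of_injective _ hzinj]
    refine W.card_nails_not_reach_to_col hYn i₀ fun v hv => ?_
    obtain ⟨i, hi, rfl⟩ := Finset.mem_image.mp hv
    exact ⟨hznail i, (Finset.mem_filter.mp hi).2⟩
  -- At most `2 * |Y| + 28 * |Y| ^ 2` paths are bad; as `|Y| < 3 * k`, this is less than `6 * k +
  -- 252 * k ^ 2`.
  obtain ⟨i, hi⟩ : ∃ i, i ∉ B₁ ∪ B₂ ∪ B₃ := by
    by_contra! hall
    have h1 : (Finset.univ : Finset (Fin h)).card ≤ (B₁ ∪ B₂ ∪ B₃).card :=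
      Finset.card_le_card fun i _ => hall i
    rw [Finset.card_univ, Fintype.card_fin] at h1
    have h2 := Finset.card_union_le (B₁ ∪ B₂) B₃
    have h3 := Finset.card_union_le B₁ B₂
    have h4 : Y.card ^ 2 ≤ (3 * k) ^ 2 := Nat.pow_le_pow_left (by omega) 2
    have h5 : (3 * k) ^ 2 = 9 * k ^ 2 := by ring
    omega
  simp only [Finset.mem_union, not_or, B₁, B₂, B₃, Finset.mem_filter, Finset.mem_univ,
    true_and] at hi
  obtain ⟨⟨hi₁, hi₂⟩, hi₃⟩ := hi
  push Not at hi₁ hi₂ hi₃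
  have hUX : ∀ (p : ℕ) (x : V), (U i)[p]? = some x → (x, p.bodd) ∈ (X : Set (V × Bool))ᶜ := fun p x hx =>
    hlift x (fun hxY => hi₁ x hxY (List.mem_of_getElem? hx)) _
  -- from the region to the segment
  obtain ⟨p, u, y, hsp, hpm, hu, hy, hyu⟩ : ∃ p u y, s i ≤ p ∧ p ≤ m i ∧ (U i)[p]? = some u ∧
      y ∈ W.region k b ∧ Reach (doubleCover H) (X : Set (V × Bool))ᶜ (y, χ y) (u, p.bodd) := by
    -- At the start of the path, and wherever the sign is `false`, the lift `(u, p.bodd)` equals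
    -- `(u, χ u)`, so wall walks from the first copy reach it.
    rcases hs i with h0 | hcard
    · obtain ⟨y, hy, hr⟩ := hi₂
      refine ⟨0, a i, y, h0.le, Nat.zero_le _, ha i, hi₀ y hy, ?_⟩
      simpa [haχ i] using hr.lift hχ hWH false fun x hx => hlift x hx _
    · obtain ⟨c, hc, hcX⟩ := exists_label_avoiding (W := W) (k := k) (X := Y)
        (lt_of_lt_of_le (by omega) hcard)
      obtain ⟨p, hsp, hpm, hsg, v, hv, hvR⟩ := mem_labelsOn.mp hc
      obtain ⟨y, hy, hr⟩ := exists_reach_from_col_of_region hYn hvR hcX i₀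
      refine ⟨p, v, y, hsp, hpm, hv, hi₀ y hy, ?_⟩
      have h1 := hr.lift hχ hWH false (S' := (X : Set (V × Bool))ᶜ) fun x hx => hlift x hx _
      have h2 := xor_liftSign (χ := χ) hv
      rw [hsg] at h2
      rw [h2] at h1
      simpa using h1
  -- from the segment to the region
  obtain ⟨p', u', y', hmp, hpt, hu', hy', hyu'⟩ : ∃ p u y, m i ≤ p ∧ p ≤ t i ∧
      (U i)[p]? = some u ∧ y ∈ W.region k b ∧
      Reach (doubleCover H) (X : Set (V × Bool))ᶜ (u, p.bodd) (y, !χ y) := by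
    rcases ht i with hend | hcard
    · obtain ⟨y, hy, hr⟩ := hi₃
      refine ⟨L i, z i, y, (hmt i).trans (htL i), hend.ge, hz i, hi₀ y hy, ?_⟩
      have h1 := hr.lift hχ hWH true (S' := (X : Set (V × Bool))ᶜ) fun x hx => hlift x hx _
      have h2 : (L i).bodd = true := by
        obtain ⟨d, hd⟩ := hL i
        rw [hd]; simp [show Nat.bodd 2 = false from rfl]
      rw [h2]
      simpa [hzχ i] using h1
    · obtain ⟨c, hc, hcX⟩ := exists_label_avoiding (W := W) (k := k) (X := Y)
        (lt_of_lt_of_le (by omega) hcard)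
      obtain ⟨p, hsp, hpm, hsg, v, hv, hvR⟩ := mem_labelsOn.mp hc
      obtain ⟨y, hy, hr⟩ := exists_reach_to_col_of_region hYn hvR hcX i₀
      refine ⟨p, v, y, hsp, hpm, hv, hi₀ y hy, ?_⟩
      have h1 := hr.lift hχ hWH true (S' := (X : Set (V × Bool))ᶜ) fun x hx => hlift x hx _
      have h2 := xor_liftSign (χ := χ) hv
      rw [hsg] at h2
      rw [h2] at h1
      simpa using h1
  refine hsep (y, χ y) ⟨hy, rfl⟩ (y', !χ y') ⟨hy', rfl⟩ (hyu.trans (Reach.trans ?_ hyu'))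
  exact Reach.of_path_doubleCover (hpm.trans hmp)
    (fun r x w h1 h2 => hUH i r x w (by omega) (by omega)) hu hu' fun r x _ _ => hUX r x

theorem exists_oddCycles_of_oddSetPaths {G : Digraph V} (hWG : W.toDigraph ≤ G) {A B N : Set V}
    (hAB : W.IsBipartition A B) (hNW : N ⊆ W.nails) (hNA : N ⊆ A) (hk : 1 ≤ k) {h : ℕ}
    (hh : 6 * k + 252 * k ^ 2 ≤ h) (hn : (12 * k * h + 1) * k ≤ n) {U : Fin h → List V}
    (hUN : ∀ i, IsOddSetPath G N (U i)) (hU : IsHalfIntegralPacking U)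
    (hends : ∀ i j, i ≠ j → Disjoint (pathEnds (U i)) (pathEnds (U j))) :
    ∃ C : Fin k → List V, (∀ i, IsOddCycle G (C i)) ∧ IsHalfIntegralPacking C := by
  classical
  obtain ⟨χ, hχA, hχ⟩ := W.exists_coloring hAB
  have hpos : ∀ i, 0 < (U i).length := fun i => List.length_pos_of_ne_nil (hUN i).path.ne_nil
  let L : Fin h → ℕ := fun i => (U i).length - 1
  let a : Fin h → V := fun i => (U i)[0]'(hpos i)
  let z : Fin h → V := fun i => (U i)[L i]'(by have := hpos i; simp only [L]; omega)
  have ha : ∀ i, (U i)[0]? = some (a i) := fun i => List.getElem?_eq_getElem _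
  have hz : ∀ i, (U i)[L i]? = some (z i) := fun i => List.getElem?_eq_getElem _
  have haend : ∀ i, a i ∈ pathEnds (U i) := fun i => .inl (by
    rw [List.head?_eq_getElem?, ha i])
  have hzend : ∀ i, z i ∈ pathEnds (U i) := fun i => .inr (by
    rw [List.getLast?_eq_getElem?]; exact hz i)
  have hainj : Function.Injective a := fun i j heq => by
    by_contra hne
    exact Set.disjoint_left.mp (hends i j hne) (haend i) (heq ▸ haend j)
  have hzinj : Function.Injective z := fun i j heq => by
    by_contra hne
    exact Set.disjoint_left.mp (hends i j hne) (hzend i) (heq ▸ hzend j)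
  have haN : ∀ i, a i ∈ N := fun i => (hUN i).ends_mem (haend i)
  have hzN : ∀ i, z i ∈ N := fun i => (hUN i).ends_mem (hzend i)
  -- With `r = 3 * k`, a separator of fewer than `3 * k` vertices misses one of the `r` regions
  -- visited.
  have hseg := fun i => exists_sign_change (q := 12 * k * h + 1) (hit := W.Hits k (U i))
    (fun _ _ _ h h' => h.unique h') (liftSign χ (U i)) (r := 3 * k) (by omega) (L i)
  choose s m t hsm hmt htL hs ht hcard using hseg
  -- a region that no segment meets
  obtain ⟨b, hbfree⟩ : ∃ b, b ∉ Finset.univ.biUnion fun i =>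
      labelsOn (W.Hits k (q := 12 * k * h + 1) (U i)) (fun _ => True) (s i) (t i) := by
    by_contra! hall
    have h1 : (Finset.univ : Finset (Fin (12 * k * h + 1))).card ≤ _ :=
      Finset.card_le_card fun c _ => hall c
    have h2 := h1.trans (Finset.card_biUnion_le_card_mul _ _ (4 * (3 * k)) fun i _ => hcard i)
    simp only [Finset.card_univ, Fintype.card_fin] at h2
    have h3 : h * (4 * (3 * k)) = 12 * k * h := by ring
    omega
  have hfree : ∀ i p x, s i ≤ p → p ≤ t i → (U i)[p]? = some x → x ∉ W.region k b := by
    intro i p x h1 h2 hx hxR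
    exact hbfree (Finset.mem_biUnion.mpr ⟨i, Finset.mem_univ _,
      mem_labelsOn.mpr ⟨p, h1, h2, trivial, x, hx, hxR⟩⟩)
  -- Only the segments are added, not the whole paths, so every edge of `H` at the free region is a
  -- wall edge.
  let H : V → V → Prop := fun x y => W.toDigraph.Adj x y ∨
    ∃ i p, s i ≤ p ∧ p + 1 ≤ t i ∧ (U i)[p]? = some x ∧ (U i)[p + 1]? = some y
  have hHG : ∀ x y, H x y → G.Adj x y := by
    rintro x y (hxy | ⟨i, p, -, -, hx, hy⟩)
    · exact hWG hxy
    · exact (hUN i).path.adj (x, y) (mem_pathEdges.mpr ⟨p, hx, hy⟩)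
  have hHR : ∀ x y, H x y → x ∈ W.region k b ∨ y ∈ W.region k b → W.toDigraph.Adj x y := by
    rintro x y (hxy | ⟨i, p, h1, h2, hx, hy⟩) hor
    · exact hxy
    · rcases hor with h | h
      · exact absurd h (hfree i p x h1 (by omega) hx)
      · exact absurd h (hfree i _ y (by omega) h2 hy)
  have hHfin : {e : V × V | H e.1 e.2}.Finite := by
    have h1 : (⋃ i, {v | v ∈ U i} ×ˢ {v | v ∈ U i}).Finite :=
      Set.finite_iUnion fun i => (List.finite_toSet _).prod (List.finite_toSet _)
    refine (W.finite_adj.union h1).subset ?_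
    rintro ⟨x, y⟩ (hxy | ⟨i, p, -, -, hx, hy⟩)
    · exact .inl hxy
    · exact .inr (Set.mem_iUnion.mpr ⟨i, List.mem_of_getElem? hx, List.mem_of_getElem? hy⟩)
  have hDfin : {e : (V × Bool) × (V × Bool) | doubleCover H e.1 e.2}.Finite := by
    refine ((hHfin.prod (Set.finite_univ (α := Bool × Bool))).image
      fun e => ((e.1.1, e.2.1), (e.1.2, e.2.2))).subset ?_
    rintro ⟨⟨x, ε⟩, ⟨y, ε'⟩⟩ ⟨hxy, -⟩
    exact ⟨((x, y), (ε, ε')), ⟨hxy, trivial⟩, rfl⟩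
  have hbn : (b.val + 1) * k ≤ n := (Nat.mul_le_mul_right k b.2).trans hn
  have hbk : b.val * k < n := by
    have : (b.val + 1) * k = b.val * k + k := by ring
    omega
  have h3k : 3 * k ≤ n := by
    have h1 : 3 ≤ 12 * k * h + 1 := by
      have : 1 * 1 ≤ k * h := Nat.mul_le_mul hk (by omega)
      rw [mul_assoc]
      omega
    exact (Nat.mul_le_mul_right k h1).trans hn
  obtain ⟨S, hS, hreach⟩ := menger (doubleCover H) hDfin (3 * k)
    {p | p.1 ∈ W.region k b ∧ p.2 = χ p.1} {p | p.1 ∈ W.region k b ∧ p.2 = !χ p.1} (by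
      intro X hXsep
      by_contra! hlt
      exact not_separates h3k hbk hk hχ (fun _ _ h => .inl h) hU
        (fun i p x y h1 h2 h3 h4 => .inr ⟨i, p, h1, h2, h3, h4⟩) hmt htL ha hz
        (fun i => (hUN i).odd) hainj hzinj (fun i => hNW (haN i)) (fun i => hNW (hzN i))
        (fun i => hχA _ (hNA (haN i))) (fun i => hχA _ (hNA (hzN i))) hs ht hh hlt hXsep)
  refine exists_oddCycles_of_linkage hχ hWG hHG hHR hbn hS fun i => ?_
  obtain ⟨⟨x, ε⟩, ⟨hx, hε⟩, ⟨y, ε'⟩, ⟨hy, hε'⟩, hr⟩ := hreach i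
  simp only at hx hε hy hε'
  subst hε hε'
  exact ⟨x, hx, y, hy, hr⟩

end CylindricalWall

end DiWall

/-! ### Choice of `g` and conclusion -/

open DiWall in
theorem proposition5p2 :
    ∃ g : ℕ → ℕ, (∀ k, 1 ≤ g k) ∧
      ∀ k : ℕ, 1 ≤ k →
      ∀ (V : Type*) (G : Digraph V) (n : ℕ) (W : CylindricalWall V n),
        (2 * k + 1) * (6 * g k + 1) ≤ n →
        W.toDigraph ≤ G →
      ∀ A B : Set V, W.IsBipartition A B →
      ∀ N : Set V, N ⊆ W.nails → N ⊆ A →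
      ∀ U : Fin (12 * (g k - 1) + 1) → List V,
        (∀ i, IsOddSetPath G N (U i)) →
        IsHalfIntegralPacking U →
        (∀ i j, i ≠ j → Disjoint (pathEnds (U i)) (pathEnds (U j))) →
      ∃ C : Fin k → List V, (∀ i, IsOddCycle G (C i)) ∧ IsHalfIntegralPacking C := by
  -- For `h = 6 * k + 252 * k ^ 2` and `g k = k * h + 1` there are `12 * k * h + 1 ≥ h` paths, and
  -- the order of the wall is at least `(12 * k * h + 1) * k`.
  refine ⟨fun k => k * (6 * k + 252 * k ^ 2) + 1, fun k => Nat.le_add_left 1 _, ?_⟩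
  intro k hk V G n W hn hWG A B hAB N hNW hNA U hUN hU hends
  have hle : 6 * k + 252 * k ^ 2 ≤ 12 * (k * (6 * k + 252 * k ^ 2) + 1 - 1) + 1 := by
    have := Nat.mul_le_mul_right (6 * k + 252 * k ^ 2) hk
    omega
  refine CylindricalWall.exists_oddCycles_of_oddSetPaths hWG hAB hNW hNA hk le_rfl ?_
    (U := fun i => U (Fin.castLE hle i)) (fun i => hUN _) ?_ ?_
  · refine le_trans ?_ hn
    dsimp only
    generalize 6 * k + 252 * k ^ 2 = h
    nlinarith [Nat.zero_le (k * h), Nat.zero_le k]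
  · intro v
    have hinj := Fin.castLE_injective hle
    rw [← hinj.encard_image]
    refine (Set.encard_le_encard ?_).trans (hU v)
    rintro _ ⟨i, hi, rfl⟩
    exact hi
  · exact fun i j hij => hends _ _ fun heq => hij (Fin.castLE_injective hle heq)
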